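/- Let $N,T\ge 1$ be integers and let $\mathbf H$ be a random vector in $\mathbb C^{N}$ whose distribution (not necessarily Gaussian) satisfies $h(\mathbf H)>-\infty$ and $\mathbb E\|\mathbf H\|^2<\infty$, where $h$ denotes differential entropy (with $h=-\infty$ if $\mathbf H$ has no density). Consider the non-coherent single-user SIMO block-fading channel with coherence time $T$, $$\mathbf Y=\mathbf H\,\mathbf X^{\mathsf T}+\mathbf Z\in\mathbb C^{N\times T},$$ where $\mathbf Z$ has i.i.d. $\mathcal{CN}(0,1)$ entries, the input $\mathbf X\in\mathbb C^{T}$, $\mathbf H$ and $\mathbf Z$ are independent, and neither the transmitter nor the receiver knows the realization of $\mathbf H$. Logarithms are in base $2$ and $\log^+x=\max\{\log x,0\}$. Then: (i) There are constants $c>0$ and $P_0$, depending only on $N$, $T$ and the distribution of $\mathbf H$, such that for every $P\ge P_0$ and every input distribution satisfying the average power constraint $\mathbb E\|\mathbf X\|^2\le PT$ (in particular, every one satisfying the peak power constraint $\|\mathbf X\|^2\le P$ almost surely), $$I(\mathbf X;\mathbf Y)\le (T-1)\log^+P+c\,\log\log P .$$ (ii) Let $C(P)=\sup\frac1T I(\mathbf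 X;\mathbf Y)$ be the capacity in bits per channel use at SNR $P$, the supremum being over all input distributions with $\mathbb E\|\mathbf X\|^2\le PT$. Every achievable number of degrees of freedom $d=\liminf_{P\to\infty}\frac{R(P)}{\log P}$, where $R(P)\le C(P)$ for all $P>0$, satisfies $$d\le 1-\frac1T .$$ -/

import Mathlib

open MeasureTheory ProbabilityTheory Filter
open scoped ENNReal

noncomputable section

namespace SIMO

/-- Differential entropy, in bits, of a law `μ` on a space with a reference (Lebesgue) volume:
`h(μ) = E[-log₂ p]`, where `p` is the density of `μ`, computed as the expectation of the positive
part minus the expectation of the negative part. It is `-∞` if `μ` has no density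
(and, in `EReal`, `∞ - ∞ = -∞`). -/
def diffEntropy {E : Type*} [MeasureSpace E] (μ : Measure E) : EReal :=
  open scoped Classical in
  if μ ≪ volume then
    ((∫⁻ y, ENNReal.ofReal (-Real.logb 2 (μ.rnDeriv volume y).toReal) ∂μ : ℝ≥0∞) : EReal)
      - ((∫⁻ y, ENNReal.ofReal (Real.logb 2 (μ.rnDeriv volume y).toReal) ∂μ : ℝ≥0∞) : EReal)
  else ⊥

/-- Mutual information `I(U;V)`, in bits: the Kullback-Leibler divergence (which Mathlib measures
in nats) between the joint law and the product of the marginal laws. -/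
def mutualInfo {Ω A B : Type*} [MeasurableSpace Ω] [MeasurableSpace A] [MeasurableSpace B]
    (U : Ω → A) (V : Ω → B) (μ : Measure Ω) : ℝ≥0∞ :=
  InformationTheory.klDiv (μ.map fun ω => (U ω, V ω)) ((μ.map U).prod (μ.map V))
    / ENNReal.ofReal (Real.log 2)

/-- The squared Euclidean norm on `ℂⁿ`. -/
def normSq {n : ℕ} (v : Fin n → ℂ) : ℝ := ∑ i, ‖v i‖ ^ 2

/-- The standard circularly symmetric complex Gaussian law `CN(0,1)`: independent real and
imaginary parts, each centred Gaussian with variance `1/2`. -/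
def stdComplexGaussian : Measure ℂ :=
  ((gaussianReal 0 (1 / 2)).prod (gaussianReal 0 (1 / 2))).map
    fun p : ℝ × ℝ => (⟨p.1, p.2⟩ : ℂ)

/-- Law of the noise: an `N × T` matrix with i.i.d. `CN(0,1)` entries. -/
def noiseLaw (N T : ℕ) : Measure (Fin N → Fin T → ℂ) :=
  Measure.pi fun _ => Measure.pi fun _ => stdComplexGaussian

/-- Law of `(X, H, Z)`: input, fading vector and noise are independent. -/
def sourceLaw {N T : ℕ} (μX : Measure (Fin T → ℂ)) (μH : Measure (Fin N → ℂ)) :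
    Measure ((Fin T → ℂ) × (Fin N → ℂ) × (Fin N → Fin T → ℂ)) :=
  μX.prod (μH.prod (noiseLaw N T))

/-- The input `X` of one coherence block. -/
def input {N T : ℕ} (ω : (Fin T → ℂ) × (Fin N → ℂ) × (Fin N → Fin T → ℂ)) : Fin T → ℂ := ω.1

/-- The output `Y = H Xᵀ + Z` of one coherence block. -/
def output {N T : ℕ} (ω : (Fin T → ℂ) × (Fin N → ℂ) × (Fin N → Fin T → ℂ)) :
    Fin N → Fin T → ℂ :=
  fun i t => ω.2.1 i * ω.1 t + ω.2.2 i t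

/-- `I(X;Y)` in bits per coherence block, for the input law `μX` and the fading law `μH`. -/
def blockInfo {N T : ℕ} (μX : Measure (Fin T → ℂ)) (μH : Measure (Fin N → ℂ)) : ℝ≥0∞ :=
  mutualInfo input output (sourceLaw μX μH)

/-- The average power constraint `E‖X‖² ≤ P T` on an input law. -/
def AveragePower {T : ℕ} (P : ℝ) (μX : Measure (Fin T → ℂ)) : Prop :=
  ∫⁻ x, ENNReal.ofReal (normSq x) ∂μX ≤ ENNReal.ofReal (P * T)

/-- The capacity at SNR `P` in bits per channel use: the supremum of `I(X;Y) / T` over the input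
distributions that satisfy the average power constraint. -/
def capacity {N : ℕ} (T : ℕ) (μH : Measure (Fin N → ℂ)) (P : ℝ) : ℝ≥0∞ :=
  ⨆ (μX : Measure (Fin T → ℂ)) (_ : IsProbabilityMeasure μX) (_ : AveragePower P μX),
    blockInfo μX μH / (T : ℝ≥0∞)

/-- `d` is an achievable number of degrees of freedom: `d = liminf R(P) / log₂ P` as `P → ∞`, for
a rate function `R` that does not exceed the capacity at any SNR. -/
def IsAchievableDoF {N : ℕ} (T : ℕ) (μH : Measure (Fin N → ℂ)) (d : EReal) : Prop :=
  ∃ R : ℝ → ℝ, (∀ P : ℝ, 0 < P → (R P : EReal) ≤ (capacity T μH P : EReal)) ∧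
    d = liminf (fun P : ℝ => ((R P / Real.logb 2 P : ℝ) : EReal)) atTop

end SIMO

end

/-!
By the golden formula, `I(X;Y) ≤ D(P_{XY} ‖ P_X ⊗ Q)` for every probability law `Q` of the output.
By the chain rule the right side only grows when `H` is adjoined to `Y`; a law of `(H, Y)` with
`Y`-marginal `Q` then has to be chosen for each input `x`. Take the entries of the first row of `Y`
independent with a tail exponent `δ`; this costs `(1 + δ) log ‖x‖²` for each of the `T` columns.
Given the first row, the gain `H₀` is known up to an error of order `(1 + ‖x‖²)^(-1/2)`, and putting
its density at that scale gives one `log ‖x‖²` back. The other rows are nearly multiples of the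
first, so their residuals do not grow with the input. What remains is integrable because `H` has
finite entropy and a finite logarithmic moment, and `δ = 1 / log P` makes the normalization of the
tails cost only `O(log log P)`.
-/

namespace SIMO

/-- The weight `exp (-c)`, as an extended nonnegative real: tilting a measure by `expNeg ∘ ℓ`
charges a loss `ℓ` in nats. -/
noncomputable def expNeg (c : ℝ) : ℝ≥0∞ := ENNReal.ofReal (Real.exp (-c))

@[fun_prop]
lemma measurable_expNeg : Measurable expNeg := by
  unfold expNeg
  fun_prop

lemma expNeg_ne_zero (c : ℝ) : expNeg c ≠ 0 := (ENNReal.ofReal_pos.2 (Real.exp_pos _)).ne'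

lemma expNeg_antitone : Antitone expNeg := fun _ _ h => by
  unfold expNeg
  gcongr

lemma expNeg_add (c d : ℝ) : expNeg (c + d) = expNeg c * expNeg d := by
  rw [expNeg, neg_add, Real.exp_add, ENNReal.ofReal_mul (Real.exp_pos _).le]
  rfl

lemma expNeg_sum {ι : Type*} (s : Finset ι) (c : ι → ℝ) :
    expNeg (∑ i ∈ s, c i) = ∏ i ∈ s, expNeg (c i) := by
  simp only [expNeg]
  rw [← ENNReal.ofReal_prod_of_nonneg fun _ _ => (Real.exp_pos _).le, ← Real.exp_sum,
    Finset.sum_neg_distrib]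

section Divergence

open InformationTheory

section

variable {Ω : Type*} [MeasurableSpace Ω] {μ ν : Measure Ω}

lemma lintegral_inv_rnDeriv_le [SigmaFinite μ] [SigmaFinite ν] (h : μ ≪ ν) :
    ∫⁻ ω, (μ.rnDeriv ν ω)⁻¹ ∂μ ≤ ν Set.univ := by
  have hinv : AEMeasurable (fun ω => (μ.rnDeriv ν ω)⁻¹) ν := by fun_prop
  rw [← lintegral_rnDeriv_mul h hinv]
  calc ∫⁻ ω, μ.rnDeriv ν ω * (μ.rnDeriv ν ω)⁻¹ ∂ν
      ≤ ∫⁻ _, 1 ∂ν := lintegral_mono fun ω => ENNReal.mul_inv_le_one _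
    _ = ν Set.univ := by simp

lemma lintegral_rnDeriv_mul_le_of_withDensity_le [SigmaFinite μ] [SigmaFinite ν] (hac : μ ≪ ν)
    {w : Ω → ℝ≥0∞} (hw : AEMeasurable w μ) (h : μ.withDensity w ≤ ν) :
    ∫⁻ ω, μ.rnDeriv ν ω * w ω ∂μ ≤ μ Set.univ :=
  calc ∫⁻ ω, μ.rnDeriv ν ω * w ω ∂μ
      = ∫⁻ ω, μ.rnDeriv ν ω ∂(μ.withDensity w) := by
        rw [lintegral_withDensity_eq_lintegral_mul₀ hw (by fun_prop)]
        simp only [Pi.mul_apply, mul_comm]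
    _ ≤ ∫⁻ ω, μ.rnDeriv ν ω ∂ν := lintegral_mono' h le_rfl
    _ = μ Set.univ := Measure.lintegral_rnDeriv hac

lemma toReal_rnDeriv_pos [SigmaFinite μ] [SigmaFinite ν] (hac : μ ≪ ν) :
    ∀ᵐ ω ∂μ, 0 < (μ.rnDeriv ν ω).toReal := by
  filter_upwards [Measure.rnDeriv_pos hac, hac.ae_le (Measure.rnDeriv_lt_top μ ν)] with ω hpos hlt
  exact ENNReal.toReal_pos hpos.ne' hlt.ne

lemma integrable_llr_of_le [IsFiniteMeasure μ] [IsFiniteMeasure ν] (hac : μ ≪ ν) {g : Ω → ℝ}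
    (hg : Integrable g μ) (h : ∀ᵐ ω ∂μ, llr μ ν ω ≤ g ω) : Integrable (llr μ ν) μ := by
  have hinv : Integrable (fun ω => ((μ.rnDeriv ν ω)⁻¹).toReal) μ :=
    integrable_toReal_of_lintegral_ne_top (by fun_prop)
      (ne_top_of_le_ne_top (measure_ne_top ν _) (lintegral_inv_rnDeriv_le hac))
  have hlower : ∀ᵐ ω ∂μ, 1 - ((μ.rnDeriv ν ω)⁻¹).toReal ≤ llr μ ν ω := by
    filter_upwards [toReal_rnDeriv_pos hac] with ω hω
    rw [llr_def, ENNReal.toReal_inv]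
    exact Real.one_sub_inv_le_log_of_pos hω
  exact integrable_of_le_of_le (measurable_llr _ _).aestronglyMeasurable hlower h
    ((integrable_const _).sub hinv) hg

/-- Integrating `log L ≤ ℓ + L exp (-ℓ) - 1`, where `L` is the density of `μ` with respect to `ν`,
gives the bound, since `∫ L exp (-ℓ) ∂μ ≤ ∫ L ∂ν`. -/
theorem klDiv_le_of_withDensity_expNeg_le [IsFiniteMeasure μ] [IsFiniteMeasure ν] {ℓ : Ω → ℝ}
    (hℓ : Integrable ℓ μ) (h : μ.withDensity (fun ω => expNeg (ℓ ω)) ≤ ν) :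
    klDiv μ ν ≤ ENNReal.ofReal (∫ ω, ℓ ω ∂μ + ν.real Set.univ - μ.real Set.univ) := by
  have hw : AEMeasurable (fun ω => expNeg (ℓ ω)) μ :=
    measurable_expNeg.comp_aemeasurable hℓ.aemeasurable
  have hac : μ ≪ ν :=
    (withDensity_absolutelyContinuous' hw (ae_of_all _ fun ω => expNeg_ne_zero _)).trans
      (Measure.absolutelyContinuous_of_le h)
  have hLw : AEMeasurable (fun ω => μ.rnDeriv ν ω * expNeg (ℓ ω)) μ := by fun_prop
  have hmass := lintegral_rnDeriv_mul_le_of_withDensity_le hac hw h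
  have hmass_ne := ne_top_of_le_ne_top (measure_ne_top _ _) hmass
  have hint := integrable_toReal_of_lintegral_ne_top hLw hmass_ne
  have hint_upper := (hℓ.add hint).sub (integrable_const (1 : ℝ))
  have hupper : ∀ᵐ ω ∂μ, llr μ ν ω ≤ ℓ ω + (μ.rnDeriv ν ω * expNeg (ℓ ω)).toReal - 1 := by
    filter_upwards [toReal_rnDeriv_pos hac] with ω hω
    have := Real.log_le_sub_one_of_pos (mul_pos hω (Real.exp_pos (-ℓ ω)))
    rw [Real.log_mul hω.ne' (Real.exp_pos _).ne', Real.log_exp] at this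
    rw [llr_def, ENNReal.toReal_mul, expNeg, ENNReal.toReal_ofReal (Real.exp_pos _).le]
    linarith
  have hint_llr := integrable_llr_of_le hac hint_upper hupper
  have hllr : ∫ ω, llr μ ν ω ∂μ ≤ ∫ ω, ℓ ω ∂μ :=
    calc ∫ ω, llr μ ν ω ∂μ
        ≤ ∫ ω, ℓ ω + (μ.rnDeriv ν ω * expNeg (ℓ ω)).toReal - 1 ∂μ :=
          integral_mono_ae hint_llr hint_upper hupper
      _ = ∫ ω, ℓ ω ∂μ + (∫⁻ ω, μ.rnDeriv ν ω * expNeg (ℓ ω) ∂μ).toReal - μ.real Set.univ := by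
          rw [integral_sub (by exact hℓ.add hint) (integrable_const _), integral_add hℓ hint,
            integral_toReal hLw (ae_lt_top' hLw hmass_ne)]
          simp
      _ ≤ ∫ ω, ℓ ω ∂μ := by
          have := ENNReal.toReal_mono (measure_ne_top μ Set.univ) hmass
          rw [Measure.real]
          linarith
  rw [klDiv_of_ac_of_integrable hac hint_llr]
  gcongr

end

/-- The chain rule writes the right-hand side as the left-hand side plus `klDiv J.fst Q`. -/
lemma klDiv_fst_prod_le {A B : Type*} [MeasurableSpace A] [MeasurableSpace B]
    [StandardBorelSpace B] [Nonempty B] (J : Measure (A × B)) [IsFiniteMeasure J]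
    (Q : Measure A) [IsFiniteMeasure Q] (P : Measure B) [IsProbabilityMeasure P] :
    klDiv J (J.fst.prod P) ≤ klDiv J (Q.prod P) := by
  have hchain := klDiv_compProd_eq_add J.fst Q J.condKernel (Kernel.const A P)
  rw [J.disintegrate J.condKernel, Measure.compProd_const, Measure.compProd_const] at hchain
  exact hchain ▸ le_add_self

lemma klDiv_prod_snd_le {A B : Type*} [MeasurableSpace A] [MeasurableSpace B]
    [StandardBorelSpace A] [Nonempty A] (J : Measure (A × B)) [IsFiniteMeasure J]
    (P : Measure A) [IsProbabilityMeasure P] (Q : Measure B) [IsFiniteMeasure Q] :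
    klDiv J (P.prod J.snd) ≤ klDiv J (P.prod Q) :=
  calc klDiv J (P.prod J.snd)
      = klDiv ((J.map Prod.swap).map Prod.swap) (((J.map Prod.swap).fst.prod P).map Prod.swap) := by
        rw [Measure.map_map measurable_swap measurable_swap, Prod.swap_swap_eq, Measure.map_id,
          Measure.prod_swap, Measure.fst_map_swap]
    _ ≤ klDiv (J.map Prod.swap) ((J.map Prod.swap).fst.prod P) := klDiv_map_le _ _ measurable_swap
    _ ≤ klDiv (J.map Prod.swap) ((P.prod Q).map Prod.swap) := by
        rw [Measure.prod_swap]
        exact klDiv_fst_prod_le _ _ _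
    _ ≤ klDiv J (P.prod Q) := klDiv_map_le _ _ measurable_swap

lemma mutualInfo_le_klDiv_prod {Ω A B : Type*} [MeasurableSpace Ω] [MeasurableSpace A]
    [StandardBorelSpace A] [Nonempty A] [MeasurableSpace B] {μ : Measure Ω}
    [IsProbabilityMeasure μ] {U : Ω → A} {V : Ω → B} (hU : Measurable U)
    (Q : Measure B) [IsFiniteMeasure Q] :
    mutualInfo U V μ ≤
      klDiv (μ.map fun ω => (U ω, V ω)) ((μ.map U).prod Q) / ENNReal.ofReal (Real.log 2) := by
  have := Measure.isProbabilityMeasure_map hU.aemeasurable (μ := μ)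
  have hsnd : (μ.map fun ω => (U ω, V ω)).snd = μ.map V := Measure.snd_map_prodMk hU
  rw [mutualInfo, ← hsnd]
  gcongr
  exact klDiv_prod_snd_le _ _ _

end Divergence

section LebesgueIntegral

lemma measure_pi_mono {ι : Type*} [Fintype ι] {α : ι → Type*} [∀ i, MeasurableSpace (α i)]
    {μ ν : ∀ i, Measure (α i)} [∀ i, SigmaFinite (μ i)] (h : ∀ i, μ i ≤ ν i) :
    Measure.pi μ ≤ Measure.pi ν := by
  have hle : (Measure.pi μ).toOuterMeasure ≤ OuterMeasure.pi fun i => (ν i).toOuterMeasure :=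
    OuterMeasure.le_pi.2 fun s _ => by
      simpa only [Measure.coe_toOuterMeasure, Measure.pi_pi] using
        Finset.prod_le_prod' fun i _ => h i (s i)
  refine Measure.le_iff.2 fun s hs => ?_
  rw [show Measure.pi ν s = OuterMeasure.pi (fun i => (ν i).toOuterMeasure) s by
    rw [Measure.pi, toMeasure_apply _ _ hs]]
  exact hle s

lemma lintegral_pi_fin_succ {n : ℕ} {α : Fin (n + 1) → Type*} [∀ i, MeasurableSpace (α i)]
    (μ : ∀ i, Measure (α i)) [∀ i, SigmaFinite (μ i)] {F : (∀ i, α i) → ℝ≥0∞}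
    (hF : Measurable F) :
    ∫⁻ x, F x ∂Measure.pi μ =
      ∫⁻ a, ∫⁻ v, F (Fin.cons a v) ∂(Measure.pi fun i => μ i.succ) ∂μ 0 := by
  rw [← (measurePreserving_piFinSuccAbove μ 0).symm.lintegral_comp hF,
    lintegral_prod _ (by fun_prop)]
  simp only [MeasurableEquiv.piFinSuccAbove_symm_apply, Fin.insertNthEquiv_zero]
  rfl

lemma lintegral_pi_fin_prod {n : ℕ} {α : Fin n → Type*} [∀ i, MeasurableSpace (α i)]
    (μ : ∀ i, Measure (α i)) [∀ i, SigmaFinite (μ i)] {f : ∀ i, α i → ℝ≥0∞}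
    (hf : ∀ i, Measurable (f i)) :
    ∫⁻ x, ∏ i, f i (x i) ∂Measure.pi μ = ∏ i, ∫⁻ a, f i a ∂μ i := by
  induction n with
  | zero => simp
  | succ n ih =>
    have hprod : Measurable fun v : ∀ i : Fin n, α i.succ => ∏ i, f i.succ (v i) := by
      fun_prop
    rw [lintegral_pi_fin_succ μ (by fun_prop)]
    simp only [Fin.prod_univ_succ, Fin.cons_zero, Fin.cons_succ]
    simp_rw [lintegral_const_mul _ hprod, ih (fun i => μ i.succ) fun i => hf i.succ]
    rw [lintegral_mul_const _ (hf 0)]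

lemma lintegral_comp_mul_left (f : ℂ → ℝ≥0∞) {c : ℂ} (hc : c ≠ 0) :
    ∫⁻ a, f (c * a) = ENNReal.ofReal (‖c‖ ^ 2)⁻¹ * ∫⁻ a, f a := by
  have hdet : LinearMap.det (LinearMap.mul ℝ ℂ c) = ‖c‖ ^ 2 := by
    rw [← Complex.normSq_eq_norm_sq, ← Algebra.norm_complex_apply, Algebra.norm_apply]
    rfl
  have hpos : 0 < ‖c‖ ^ 2 := by positivity
  have hmap := Measure.map_linearMap_addHaar_eq_smul_addHaar (volume : Measure ℂ)
    (f := LinearMap.mul ℝ ℂ c) (by rw [hdet]; exact hpos.ne')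
  rw [hdet, abs_of_pos (inv_pos.2 hpos)] at hmap
  have hemb : MeasurableEmbedding (LinearMap.mul ℝ ℂ c) :=
    (Homeomorph.mulLeft₀ c hc).measurableEmbedding
  rw [← smul_eq_mul, ← lintegral_smul_measure, ← hmap, hemb.lintegral_map]
  rfl

lemma lintegral_inv_norm_sq_mul_comp_div {f : ℂ → ℝ≥0∞} (hf : Measurable f) {c : ℂ} (hc : c ≠ 0) :
    ∫⁻ a, ENNReal.ofReal (‖c‖ ^ 2)⁻¹ * f (a / c) = ∫⁻ a, f a := by
  have hpos : 0 < ‖c‖ ^ 2 := by positivity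
  simp_rw [div_eq_inv_mul]
  rw [lintegral_const_mul _ (by fun_prop), lintegral_comp_mul_left f (inv_ne_zero hc), ← mul_assoc,
    ← ENNReal.ofReal_mul (by positivity), norm_inv, inv_pow, inv_inv, inv_mul_cancel₀ hpos.ne',
    ENNReal.ofReal_one, one_mul]

lemma lintegral_comp_norm {f : ℝ → ℝ≥0∞} (hf : Measurable f) :
    ∫⁻ a : ℂ, f ‖a‖ =
      ENNReal.ofReal (2 * Real.pi) * ∫⁻ r in Set.Ioi (0 : ℝ), ENNReal.ofReal r * f r := by
  rw [← Complex.lintegral_comp_polarCoord_symm, polarCoord_target]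
  calc ∫⁻ p in Set.Ioi (0 : ℝ) ×ˢ Set.Ioo (-Real.pi) Real.pi,
        ENNReal.ofReal p.1 • f ‖Complex.polarCoord.symm p‖
      = ∫⁻ p in Set.Ioi (0 : ℝ) ×ˢ Set.Ioo (-Real.pi) Real.pi, ENNReal.ofReal p.1 * f p.1 :=
        setLIntegral_congr_fun (measurableSet_Ioi.prod measurableSet_Ioo) fun p hp => by
          simp only [Complex.norm_polarCoord_symm, smul_eq_mul, abs_of_pos (show 0 < p.1 from hp.1)]
    _ = ∫⁻ r in Set.Ioi (0 : ℝ), ENNReal.ofReal r * f r * ENNReal.ofReal (2 * Real.pi) := by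
        rw [Measure.volume_eq_prod, ← Measure.prod_restrict, lintegral_prod _ (by fun_prop)]
        simp only [lintegral_const, Measure.restrict_apply_univ, Real.volume_Ioo, sub_neg_eq_add,
          two_mul]
    _ = _ := by rw [lintegral_mul_const _ (by fun_prop), mul_comm]

end LebesgueIntegral

section HeavyTail

/-- The rotation-invariant probability density `(δ / π) (1 + |a|²)⁻¹⁻ᵟ` on the plane. For small
`δ` it is almost as heavy-tailed as a density can be, so that its logarithm grows as slowly as
possible. -/
noncomputable def heavyTail (δ : ℝ) (a : ℂ) : ℝ≥0∞ :=
  ENNReal.ofReal (δ / Real.pi * (1 + ‖a‖ ^ 2) ^ (-(1 + δ)))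

@[fun_prop]
lemma measurable_heavyTail (δ : ℝ) : Measurable (heavyTail δ) := by
  unfold heavyTail
  fun_prop

lemma lintegral_Ioi_mul_one_add_sq_rpow {δ : ℝ} (hδ : 0 < δ) :
    ∫⁻ r in Set.Ioi (0 : ℝ), ENNReal.ofReal (2 * δ * (r * (1 + r ^ 2) ^ (-(1 + δ)))) = 1 := by
  have hderiv : ∀ r ∈ Set.Ici (0 : ℝ), HasDerivAt (fun r : ℝ => -(1 + r ^ 2) ^ (-δ))
      (2 * δ * (r * (1 + r ^ 2) ^ (-(1 + δ)))) r := by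
    intro r _
    have hsq : HasDerivAt (fun r : ℝ => 1 + r ^ 2) (2 * r) r := by
      simpa using (hasDerivAt_pow 2 r).const_add 1
    refine (hsq.rpow_const (p := -δ) (Or.inl (by positivity))).neg.congr_deriv ?_
    rw [show -δ - 1 = -(1 + δ) by ring]
    ring
  have hnonneg : ∀ r ∈ Set.Ioi (0 : ℝ), 0 ≤ 2 * δ * (r * (1 + r ^ 2) ^ (-(1 + δ))) := by
    intro r (hr : 0 < r)
    positivity
  have hlim : Tendsto (fun r : ℝ => -(1 + r ^ 2) ^ (-δ)) atTop (nhds 0) := by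
    have hsq : Tendsto (fun r : ℝ => 1 + r ^ 2) atTop atTop :=
      tendsto_atTop_add_const_left _ _ (tendsto_pow_atTop two_ne_zero)
    simpa using ((tendsto_rpow_neg_atTop hδ).comp hsq).neg
  rw [← ofReal_integral_eq_lintegral_ofReal (integrableOn_Ioi_deriv_of_nonneg' hderiv hnonneg hlim)
    ((ae_restrict_iff' measurableSet_Ioi).2 (ae_of_all _ hnonneg)),
    integral_Ioi_of_hasDerivAt_of_nonneg' hderiv hnonneg hlim]
  simp

lemma lintegral_heavyTail {δ : ℝ} (hδ : 0 < δ) : ∫⁻ a, heavyTail δ a = 1 := by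
  simp only [heavyTail]
  rw [lintegral_comp_norm (f := fun r => ENNReal.ofReal (δ / Real.pi * (1 + r ^ 2) ^ (-(1 + δ))))
    (by fun_prop), ← lintegral_const_mul _ (by fun_prop), ← lintegral_Ioi_mul_one_add_sq_rpow hδ]
  refine setLIntegral_congr_fun measurableSet_Ioi fun r (hr : 0 < r) => ?_
  rw [← ENNReal.ofReal_mul hr.le, ← ENNReal.ofReal_mul (by positivity)]
  congr 1
  field_simp

end HeavyTail

section LogSize

lemma log_one_add_le_self {r : ℝ} (hr : 0 ≤ r) : Real.log (1 + r) ≤ r := by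
  linarith [Real.log_le_sub_one_of_pos (show 0 < 1 + r by linarith)]

lemma integrable_log_one_add {Ω : Type*} [MeasurableSpace Ω] {μ : Measure Ω} {f : Ω → ℝ}
    (hf : Integrable f μ) (hf_nonneg : ∀ ω, 0 ≤ f ω) :
    Integrable (fun ω => Real.log (1 + f ω)) μ := by
  refine hf.mono' (hf.aemeasurable.const_add 1).log.aestronglyMeasurable
    (ae_of_all _ fun ω => ?_)
  rw [Real.norm_of_nonneg (Real.log_nonneg (by linarith [hf_nonneg ω]))]
  exact log_one_add_le_self (hf_nonneg ω)

/-- The logarithmic size `log (1 + |a|²)`, in nats; unlike `log |a|²` it is nonnegative, and it is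
subadditive up to a constant. -/
noncomputable def logSize (a : ℂ) : ℝ := Real.log (1 + ‖a‖ ^ 2)

@[fun_prop]
lemma measurable_logSize : Measurable logSize := by
  unfold logSize
  fun_prop

lemma logSize_nonneg (a : ℂ) : 0 ≤ logSize a :=
  Real.log_nonneg (by nlinarith [sq_nonneg ‖a‖])

lemma logSize_neg (a : ℂ) : logSize (-a) = logSize a := by
  rw [logSize, norm_neg, logSize]

lemma logSize_add_le (a b : ℂ) : logSize (a + b) ≤ 1 + logSize a + logSize b := by
  have hle : 1 + ‖a + b‖ ^ 2 ≤ 2 * ((1 + ‖a‖ ^ 2) * (1 + ‖b‖ ^ 2)) := by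
    have : ‖a + b‖ ^ 2 ≤ (‖a‖ + ‖b‖) ^ 2 := by gcongr; exact norm_add_le a b
    nlinarith [sq_nonneg (‖a‖ - ‖b‖), sq_nonneg (‖a‖ * ‖b‖)]
  have hlog := Real.log_le_log (by positivity) hle
  rw [Real.log_mul two_ne_zero (by positivity), Real.log_mul (by positivity) (by positivity)]
    at hlog
  unfold logSize
  linarith [Real.log_two_lt_d9]

lemma logSize_mul_le (a b : ℂ) : logSize (a * b) ≤ logSize a + logSize b := by
  unfold logSize
  rw [← Real.log_mul (by positivity) (by positivity)]
  refine Real.log_le_log (by positivity) ?_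
  rw [norm_mul]
  nlinarith [sq_nonneg ‖a‖, sq_nonneg ‖b‖]

lemma logSize_inv_le {b : ℂ} (hb : b ≠ 0) :
    logSize b⁻¹ ≤ logSize b + 2 * Real.posLog ‖b‖⁻¹ := by
  calc logSize b⁻¹
      = Real.log ((1 + ‖b‖ ^ 2) * ‖b‖⁻¹ ^ 2) := by
        rw [logSize, norm_inv]
        congr 1
        field_simp
        ring
    _ = logSize b + 2 * Real.log ‖b‖⁻¹ := by
        rw [Real.log_mul (by positivity) (by positivity), Real.log_pow, logSize]
        norm_num
    _ ≤ logSize b + 2 * Real.posLog ‖b‖⁻¹ := by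
        gcongr
        exact le_max_right _ _

lemma logSize_div_le (a : ℂ) {b : ℂ} (hb : b ≠ 0) :
    logSize (a / b) ≤ logSize a + logSize b + 2 * Real.posLog ‖b‖⁻¹ := by
  rw [div_eq_mul_inv]
  linarith [logSize_mul_le a b⁻¹, logSize_inv_le hb]

lemma normSq_nonneg {n : ℕ} (v : Fin n → ℂ) : 0 ≤ normSq v :=
  Finset.sum_nonneg fun _ _ => by positivity

@[fun_prop]
lemma measurable_normSq {n : ℕ} : Measurable (normSq (n := n)) := by
  unfold normSq
  fun_prop

lemma log_one_add_normSq_nonneg {n : ℕ} (v : Fin n → ℂ) : 0 ≤ Real.log (1 + normSq v) :=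
  Real.log_nonneg (by linarith [normSq_nonneg v])

lemma logSize_apply_le {n : ℕ} (v : Fin n → ℂ) (i : Fin n) :
    logSize (v i) ≤ Real.log (1 + normSq v) := by
  have : ‖v i‖ ^ 2 ≤ normSq v :=
    Finset.single_le_sum (f := fun i => ‖v i‖ ^ 2) (fun _ _ => by positivity) (Finset.mem_univ i)
  unfold logSize
  gcongr

lemma log_pi_le_two : Real.log Real.pi ≤ 2 := by
  rw [Real.log_le_iff_le_exp Real.pi_pos]
  calc Real.pi ≤ 2 * 2 := by linarith [Real.pi_le_four]
    _ ≤ Real.exp 1 * Real.exp 1 := by gcongr <;> linarith [Real.exp_one_gt_d9]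
    _ = Real.exp 2 := by rw [← Real.exp_add]; norm_num

lemma heavyTail_eq_expNeg {δ : ℝ} (hδ : 0 < δ) (a : ℂ) :
    heavyTail δ a = expNeg (Real.log Real.pi + Real.log (1 / δ) + (1 + δ) * logSize a) := by
  have hpi := Real.pi_pos
  have hpos : 0 < 1 + ‖a‖ ^ 2 := by positivity
  rw [heavyTail, expNeg, logSize,
    ← Real.exp_log (show 0 < δ / Real.pi * (1 + ‖a‖ ^ 2) ^ (-(1 + δ)) by positivity),
    Real.log_mul (by positivity) (by positivity), Real.log_rpow hpos,
    Real.log_div hδ.ne' hpi.ne', one_div, Real.log_inv]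
  ring_nf

lemma expNeg_le_heavyTail {δ : ℝ} (hδ : 0 < δ) (a : ℂ) :
    expNeg (2 + Real.log (1 / δ) + (1 + δ) * logSize a) ≤ heavyTail δ a := by
  rw [heavyTail_eq_expNeg hδ]
  exact expNeg_antitone (by gcongr; exact log_pi_le_two)

lemma expNeg_le_heavyTail_one (a : ℂ) : expNeg (2 + 2 * logSize a) ≤ heavyTail 1 a := by
  simpa [one_add_one_eq_two] using expNeg_le_heavyTail one_pos a

end LogSize

section Noise

instance isProbabilityMeasure_stdComplexGaussian : IsProbabilityMeasure stdComplexGaussian :=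
  Measure.isProbabilityMeasure_map Complex.measurableEquivRealProd.symm.measurable.aemeasurable

instance isProbabilityMeasure_noiseLaw (N T : ℕ) : IsProbabilityMeasure (noiseLaw N T) := by
  unfold noiseLaw
  infer_instance

lemma gaussianReal_le_volume (m : ℝ) {v : NNReal} (hv : 1 ≤ 2 * Real.pi * v) :
    gaussianReal m v ≤ volume := by
  have hv0 : v ≠ 0 := by
    rintro rfl
    norm_num at hv
  rw [gaussianReal_of_var_ne_zero _ hv0]
  conv_rhs => rw [← withDensity_one (μ := (volume : Measure ℝ))]
  refine withDensity_mono (ae_of_all _ fun x => ?_)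
  rw [Pi.one_apply, gaussianPDF, gaussianPDFReal, ENNReal.ofReal_le_one]
  refine mul_le_one₀ (inv_le_one_of_one_le₀ (Real.one_le_sqrt.2 hv)) (Real.exp_pos _).le ?_
  rw [Real.exp_le_one_iff, neg_div, neg_nonpos]
  positivity

lemma stdComplexGaussian_le_volume : stdComplexGaussian ≤ volume := by
  have hreal : gaussianReal 0 (1 / 2) ≤ volume := gaussianReal_le_volume 0 (by
    push_cast
    linarith [Real.pi_gt_three])
  rw [← Complex.volume_preserving_equiv_real_prod.symm.map_eq]
  exact Measure.map_mono (Measure.prod_mono hreal hreal)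
    Complex.measurableEquivRealProd.symm.measurable

lemma noiseLaw_le_volume (N T : ℕ) : noiseLaw N T ≤ volume :=
  measure_pi_mono fun _ => measure_pi_mono fun _ => stdComplexGaussian_le_volume

lemma integrable_norm_sq_stdComplexGaussian :
    Integrable (fun z : ℂ => ‖z‖ ^ 2) stdComplexGaussian := by
  have hsq : Integrable (fun x : ℝ => x ^ 2) (gaussianReal 0 (1 / 2)) :=
    (memLp_id_gaussianReal (μ := 0) (v := 1 / 2) 2).integrable_sq
  have hmk : Measurable fun p : ℝ × ℝ => (⟨p.1, p.2⟩ : ℂ) :=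
    Complex.measurableEquivRealProd.symm.measurable
  rw [stdComplexGaussian, integrable_map_measure (by fun_prop) hmk.aemeasurable]
  refine ((hsq.comp_fst _).add (hsq.comp_snd _)).congr (ae_of_all _ fun p => ?_)
  simp only [Pi.add_apply, Function.comp_apply, ← Complex.normSq_eq_norm_sq, Complex.normSq_mk]
  ring

lemma integrable_normSq_noiseLaw {N T : ℕ} (i : Fin N) :
    Integrable (fun z : Fin N → Fin T → ℂ => normSq (z i)) (noiseLaw N T) :=
  integrable_finsetSum _ fun t _ =>
    ((measurePreserving_eval (fun _ : Fin T => stdComplexGaussian) t).comp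
      (measurePreserving_eval (fun _ : Fin N => Measure.pi fun _ : Fin T => stdComplexGaussian) i)
      ).integrable_comp_of_integrable integrable_norm_sq_stdComplexGaussian

end Noise

section Entropy

lemma posLog_le_self {r : ℝ} (hr : 0 ≤ r) : Real.posLog r ≤ r :=
  max_le hr (Real.log_le_self hr)

section

variable {E : Type*} [MeasurableSpace E] {μ ν : Measure E}

lemma withDensity_expNeg_posLog_rnDeriv_le [SigmaFinite μ] [SigmaFinite ν] (hac : μ ≪ ν) :
    μ.withDensity (fun h => expNeg (Real.posLog (μ.rnDeriv ν h).toReal)) ≤ ν := by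
  have hle : ∀ᵐ h ∂ν, μ.rnDeriv ν h * expNeg (Real.posLog (μ.rnDeriv ν h).toReal) ≤ 1 := by
    filter_upwards [Measure.rnDeriv_lt_top μ ν] with h hlt
    rw [← ENNReal.ofReal_toReal hlt.ne, expNeg, ← ENNReal.ofReal_mul ENNReal.toReal_nonneg,
      ENNReal.ofReal_le_one, ENNReal.toReal_ofReal ENNReal.toReal_nonneg, Real.exp_neg,
      ← div_eq_mul_inv, div_le_one (Real.exp_pos _)]
    exact (Real.le_exp_log _).trans (Real.exp_le_exp.2 (le_max_right _ _))
  calc μ.withDensity (fun h => expNeg (Real.posLog (μ.rnDeriv ν h).toReal))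
      = ν.withDensity (fun h => μ.rnDeriv ν h * expNeg (Real.posLog (μ.rnDeriv ν h).toReal)) := by
        refine .symm ((withDensity_mul ν (Measure.measurable_rnDeriv μ ν) (by fun_prop)).trans ?_)
        rw [Measure.withDensity_rnDeriv_eq μ ν hac]
    _ ≤ ν.withDensity 1 := withDensity_mono hle
    _ = ν := withDensity_one

/-- With `p` the density of `μ`, the bound `log⁺ θ ≤ log⁺ p + θ / p` is integrated against `μ`. -/
lemma integrable_posLog_of_lintegral_ne_top [SigmaFinite μ] [SigmaFinite ν]
    (hac : μ ≪ ν) (hlog : Integrable (fun h => Real.posLog (μ.rnDeriv ν h).toReal) μ) {θ : E → ℝ}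
    (hθ : Measurable θ) (hθ_nonneg : ∀ h, 0 ≤ θ h) (hθ_fin : ∫⁻ h, ENNReal.ofReal (θ h) ∂ν ≠ ∞) :
    Integrable (fun h => Real.posLog (θ h)) μ := by
  set p := μ.rnDeriv ν
  have hquot_fin : ∫⁻ h, ENNReal.ofReal (θ h) * (p h)⁻¹ ∂μ ≠ ∞ := by
    refine ne_top_of_le_ne_top hθ_fin ?_
    rw [← lintegral_rnDeriv_mul (f := fun h => ENNReal.ofReal (θ h) * (p h)⁻¹) hac (by fun_prop)]
    refine lintegral_mono fun h => ?_
    rw [mul_left_comm]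
    exact mul_le_of_le_one_right' (ENNReal.mul_inv_le_one _)
  have hquot := integrable_toReal_of_lintegral_ne_top (μ := μ)
    (f := fun h => ENNReal.ofReal (θ h) * (p h)⁻¹) (by fun_prop) hquot_fin
  refine (hlog.add hquot).mono' (by fun_prop) ?_
  filter_upwards [toReal_rnDeriv_pos hac] with h hp
  rw [Real.norm_of_nonneg Real.posLog_nonneg]
  have hval : (ENNReal.ofReal (θ h) * (p h)⁻¹).toReal = θ h / (p h).toReal := by
    rw [ENNReal.toReal_mul, ENNReal.toReal_inv, ENNReal.toReal_ofReal (hθ_nonneg h), div_eq_mul_inv]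
  calc Real.posLog (θ h)
      = Real.posLog ((p h).toReal * (θ h / (p h).toReal)) := by rw [mul_div_cancel₀ _ hp.ne']
    _ ≤ Real.posLog (p h).toReal + Real.posLog (θ h / (p h).toReal) := Real.posLog_mul
    _ ≤ Real.posLog (p h).toReal + θ h / (p h).toReal := by
        gcongr
        exact posLog_le_self (div_nonneg (hθ_nonneg h) hp.le)
    _ = _ := by rw [← hval]; rfl

end

lemma absolutelyContinuous_of_bot_lt_diffEntropy {E : Type*} [MeasureSpace E] {μ : Measure E}
    (h : ⊥ < diffEntropy μ) : μ ≪ volume := by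
  by_contra hac
  simp [diffEntropy, hac] at h

lemma integrable_posLog_rnDeriv_of_bot_lt_diffEntropy {E : Type*} [MeasureSpace E]
    {μ : Measure E} (h : ⊥ < diffEntropy μ) :
    Integrable (fun y => Real.posLog (μ.rnDeriv volume y).toReal) μ := by
  have hac := absolutelyContinuous_of_bot_lt_diffEntropy h
  have hfin : ∫⁻ y, ENNReal.ofReal (Real.logb 2 (μ.rnDeriv volume y).toReal) ∂μ ≠ ∞ := by
    intro htop
    simp [diffEntropy, hac, htop] at h
  have hbits : ∀ y, Real.posLog (μ.rnDeriv volume y).toReal =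
      (ENNReal.ofReal (Real.logb 2 (μ.rnDeriv volume y).toReal)).toReal * Real.log 2 := by
    intro y
    rw [ENNReal.toReal_ofReal', max_mul_of_nonneg _ _ (Real.log_nonneg one_le_two), zero_mul,
      Real.logb, div_mul_cancel₀ _ (Real.log_pos one_lt_two).ne', max_comm, Real.posLog_apply]
  simp_rw [hbits]
  have hmeas : Measurable fun y => Real.logb 2 (μ.rnDeriv volume y).toReal :=
    (Measure.measurable_rnDeriv _ _).ennreal_toReal.log.div_const _
  exact (integrable_toReal_of_lintegral_ne_top hmeas.ennreal_ofReal.aemeasurable hfin).mul_const _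

lemma lintegral_inv_norm_mul_heavyTail_ne_top :
    ∫⁻ a : ℂ, ENNReal.ofReal ‖a‖⁻¹ * heavyTail 1 a ≠ ∞ := by
  have hpi := Real.pi_pos
  have hint : Integrable (fun r : ℝ => (1 + r ^ 2)⁻¹) := integrable_inv_one_add_sq
  simp only [heavyTail]
  rw [lintegral_comp_norm (f := fun r : ℝ => ENNReal.ofReal r⁻¹ *
    ENNReal.ofReal (1 / Real.pi * (1 + r ^ 2) ^ (-(1 + 1) : ℝ))) (by fun_prop)]
  refine ENNReal.mul_ne_top ENNReal.ofReal_ne_top ?_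
  refine ne_top_of_le_ne_top hint.lintegral_lt_top.ne
    ((setLIntegral_mono (by fun_prop) fun r (hr : 0 < r) => ?_).trans
      (setLIntegral_le_lintegral _ _))
  rw [← ENNReal.ofReal_mul (by positivity), ← ENNReal.ofReal_mul hr.le, ← mul_assoc,
    mul_inv_cancel₀ hr.ne', one_mul]
  gcongr
  have hbase : (1 + r ^ 2) ^ (-(1 + 1) : ℝ) ≤ (1 + r ^ 2) ^ (-1 : ℝ) :=
    Real.rpow_le_rpow_of_exponent_le (by nlinarith) (by norm_num)
  rw [Real.rpow_neg_one] at hbase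
  have hinv : 1 / Real.pi ≤ 1 := by
    rw [div_le_one hpi]
    linarith [Real.pi_gt_three]
  exact (mul_le_of_le_one_left (by positivity) hinv).trans hbase

lemma posLog_inv_toReal_heavyTail_one_le (a : ℂ) :
    Real.posLog (heavyTail 1 a).toReal⁻¹ ≤ 2 + 2 * logSize a := by
  have hexp : Real.exp (-(2 + 2 * logSize a)) ≤ (heavyTail 1 a).toReal := by
    rw [← ENNReal.toReal_ofReal (Real.exp_pos _).le]
    exact ENNReal.toReal_mono ENNReal.ofReal_ne_top (expNeg_le_heavyTail_one a)
  have hpos := (Real.exp_pos _).trans_le hexp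
  refine max_le (by linarith [logSize_nonneg a]) ?_
  rw [Real.log_inv, neg_le]
  exact (Real.le_log_iff_exp_le hpos).2 hexp

lemma lintegral_inv_norm_mul_prod_heavyTail_ne_top {n : ℕ} (k : Fin n) :
    ∫⁻ h : Fin n → ℂ, ENNReal.ofReal (‖h k‖⁻¹ * ∏ i, (heavyTail 1 (h i)).toReal) ≠ ∞ := by
  set f : Fin n → ℂ → ℝ≥0∞ :=
    fun i a => (if i = k then ENNReal.ofReal ‖a‖⁻¹ else 1) * heavyTail 1 a with hf
  have hprod : ∀ h : Fin n → ℂ,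
      ENNReal.ofReal (‖h k‖⁻¹ * ∏ i, (heavyTail 1 (h i)).toReal) = ∏ i, f i (h i) := by
    intro h
    rw [ENNReal.ofReal_mul (by positivity),
      ENNReal.ofReal_prod_of_nonneg fun _ _ => ENNReal.toReal_nonneg, Finset.prod_mul_distrib]
    simp [heavyTail]
  simp_rw [hprod]
  rw [volume_pi, lintegral_pi_fin_prod _ fun i => by simp only [hf]; split_ifs <;> fun_prop]
  refine ENNReal.prod_ne_top fun i _ => ?_
  by_cases hik : i = k
  · simpa [hf, hik] using lintegral_inv_norm_mul_heavyTail_ne_top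
  · simp [hf, hik, lintegral_heavyTail one_pos]

/-- Apply `integrable_posLog_of_lintegral_ne_top` to `|h k|⁻¹` times a product of heavy tails, which
has a finite integral because `|a|⁻¹` is locally integrable on the plane. -/
lemma integrable_posLog_inv_norm {n : ℕ} {μ : Measure (Fin n → ℂ)} [IsFiniteMeasure μ]
    (hent : ⊥ < diffEntropy μ) (hlog : Integrable (fun h => Real.log (1 + normSq h)) μ)
    (k : Fin n) : Integrable (fun h => Real.posLog ‖h k‖⁻¹) μ := by
  set θ : (Fin n → ℂ) → ℝ := fun h => ‖h k‖⁻¹ * ∏ i, (heavyTail 1 (h i)).toReal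
  have hposLog := integrable_posLog_of_lintegral_ne_top
    (absolutelyContinuous_of_bot_lt_diffEntropy hent)
    (integrable_posLog_rnDeriv_of_bot_lt_diffEntropy hent) (θ := θ) (by fun_prop)
    (fun h => by positivity) (lintegral_inv_norm_mul_prod_heavyTail_ne_top k)
  refine (hposLog.add (((integrable_const 2).add (hlog.const_mul 2)).const_mul n)).mono'
    (Measurable.aestronglyMeasurable (by fun_prop)) (ae_of_all _ fun h => ?_)
  rw [Real.norm_of_nonneg Real.posLog_nonneg]
  have hθ_ne : ∏ i, (heavyTail 1 (h i)).toReal ≠ 0 := Finset.prod_ne_zero_iff.2 fun i _ => by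
    rw [heavyTail_eq_expNeg one_pos]
    exact (ENNReal.toReal_pos (expNeg_ne_zero _) ENNReal.ofReal_ne_top).ne'
  calc Real.posLog ‖h k‖⁻¹
      = Real.posLog (θ h * ∏ i, (heavyTail 1 (h i)).toReal⁻¹) := by
        rw [Finset.prod_inv_distrib, mul_assoc, mul_inv_cancel₀ hθ_ne, mul_one]
    _ ≤ Real.posLog (θ h) + ∑ i, Real.posLog (heavyTail 1 (h i)).toReal⁻¹ :=
        Real.posLog_mul.trans (by gcongr; exact Real.posLog_prod _ _)
    _ ≤ Real.posLog (θ h) + ∑ _i : Fin n, (2 + 2 * Real.log (1 + normSq h)) := by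
        gcongr with i
        exact (posLog_inv_toReal_heavyTail_one_le _).trans
          (by gcongr; exact logSize_apply_le h i)
    _ = _ := by simp [mul_add]

end Entropy

section LatentModel

variable {n T : ℕ}

/-- Auxiliary joint density of the ratio `a` of two fading coefficients and a row `y` of the
output, given the reference row `y₀`: since `Y` is close to `H Xᵀ`, the row `y` is close to
`a y₀`. -/
noncomputable def rowDensity (y₀ y : Fin T → ℂ) (a : ℂ) : ℝ≥0∞ :=
  heavyTail 1 a * ∏ t, heavyTail 1 (y t - a * y₀ t)

/-- Auxiliary output density: a heavy-tailed row `0`, and the other rows near random multiples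
of it. -/
noncomputable def outputDensity (δ : ℝ) (y : Fin (n + 1) → Fin T → ℂ) : ℝ≥0∞ :=
  (∏ t, heavyTail δ (y 0 t)) * ∏ i : Fin n, ∫⁻ a, rowDensity (y 0) (y i.succ) a

/-- Auxiliary density of the fading coefficient `h₀`, given the input `x` and row `0` of the
output: it is centred at the regularized least-squares estimate of `h₀`, at scale
`(1 + ‖x‖²)^(-1/2)`. -/
noncomputable def gainDensity (x y₀ : Fin T → ℂ) (h₀ : ℂ) : ℝ≥0∞ :=
  ENNReal.ofReal (1 + normSq x) *
    heavyTail 1 (√(1 + normSq x) * (h₀ - (∑ t, star (x t) * y₀ t) / (1 + normSq x)))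

/-- Auxiliary joint density of the fading vector and the output, given the input `x`. Its output
marginal `outputDensity δ` does not depend on `x`. The factors `‖h 0‖⁻²` are the Jacobian of
`h ↦ (h 0, h 1 / h 0, …, h n / h 0)`. -/
noncomputable def latentDensity (δ : ℝ) (x : Fin T → ℂ) (h : Fin (n + 1) → ℂ)
    (y : Fin (n + 1) → Fin T → ℂ) : ℝ≥0∞ :=
  (∏ t, heavyTail δ (y 0 t)) *
    (∏ i : Fin n, ENNReal.ofReal (‖h 0‖ ^ 2)⁻¹ * rowDensity (y 0) (y i.succ) (h i.succ / h 0)) *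
    gainDensity x (y 0) (h 0)

section Measurability

variable {Ω : Type*} [MeasurableSpace Ω]

@[fun_prop]
lemma measurable_rowDensity {y₀ y : Ω → Fin T → ℂ} {a : Ω → ℂ} (hy₀ : Measurable y₀)
    (hy : Measurable y) (ha : Measurable a) :
    Measurable fun ω => rowDensity (y₀ ω) (y ω) (a ω) := by
  unfold rowDensity
  fun_prop

@[fun_prop]
lemma measurable_lintegral_rowDensity {y₀ y : Ω → Fin T → ℂ} (hy₀ : Measurable y₀)
    (hy : Measurable y) : Measurable fun ω => ∫⁻ a, rowDensity (y₀ ω) (y ω) a :=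
  Measurable.lintegral_prod_right' (f := fun p : Ω × ℂ => rowDensity (y₀ p.1) (y p.1) p.2)
    (by fun_prop)

@[fun_prop]
lemma measurable_outputDensity (δ : ℝ) : Measurable (outputDensity (n := n) (T := T) δ) := by
  unfold outputDensity
  fun_prop

@[fun_prop]
lemma measurable_gainDensity {x y₀ : Ω → Fin T → ℂ} {h₀ : Ω → ℂ} (hx : Measurable x)
    (hy₀ : Measurable y₀) (hh₀ : Measurable h₀) :
    Measurable fun ω => gainDensity (x ω) (y₀ ω) (h₀ ω) := by
  unfold gainDensity
  fun_prop

@[fun_prop]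
lemma measurable_latentDensity (δ : ℝ) {x : Ω → Fin T → ℂ} {h : Ω → Fin (n + 1) → ℂ}
    {y : Ω → Fin (n + 1) → Fin T → ℂ} (hx : Measurable x) (hh : Measurable h)
    (hy : Measurable y) : Measurable fun ω => latentDensity δ (x ω) (h ω) (y ω) := by
  unfold latentDensity
  fun_prop

end Measurability

lemma lintegral_gainDensity (x y₀ : Fin T → ℂ) : ∫⁻ h₀, gainDensity x y₀ h₀ = 1 := by
  have hx : 0 < 1 + normSq x := by linarith [normSq_nonneg x]
  have hsqrt : (√(1 + normSq x) : ℂ) ≠ 0 := by exact_mod_cast (Real.sqrt_pos.2 hx).ne'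
  unfold gainDensity
  rw [lintegral_const_mul _ (by fun_prop),
    lintegral_sub_right_eq_self (fun u => heavyTail 1 (√(1 + normSq x) * u)),
    lintegral_comp_mul_left _ hsqrt, lintegral_heavyTail one_pos, mul_one, Complex.norm_real,
    Real.norm_eq_abs, sq_abs, Real.sq_sqrt hx.le, ← ENNReal.ofReal_mul hx.le,
    mul_inv_cancel₀ hx.ne', ENNReal.ofReal_one]

lemma lintegral_lintegral_rowDensity (y₀ : Fin T → ℂ) : ∫⁻ y, ∫⁻ a, rowDensity y₀ y a = 1 := by
  rw [lintegral_lintegral_swap (by fun_prop)]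
  calc ∫⁻ a, ∫⁻ y, rowDensity y₀ y a
      = ∫⁻ a, heavyTail 1 a := lintegral_congr fun a => by
        unfold rowDensity
        rw [lintegral_const_mul _ (by fun_prop), volume_pi,
          lintegral_pi_fin_prod _ (f := fun t b => heavyTail 1 (b - a * y₀ t)) (by fun_prop)]
        simp only [lintegral_sub_right_eq_self, lintegral_heavyTail one_pos, Finset.prod_const_one,
          mul_one]
    _ = 1 := lintegral_heavyTail one_pos

lemma lintegral_outputDensity {δ : ℝ} (hδ : 0 < δ) :
    ∫⁻ y, outputDensity (n := n) (T := T) δ y = 1 := by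
  rw [volume_pi, lintegral_pi_fin_succ _ (measurable_outputDensity δ)]
  simp only [outputDensity, Fin.cons_zero, Fin.cons_succ]
  calc ∫⁻ y₀ : Fin T → ℂ, ∫⁻ v : Fin n → Fin T → ℂ,
        (∏ t, heavyTail δ (y₀ t)) * (∏ i, ∫⁻ a, rowDensity y₀ (v i) a)
          ∂(Measure.pi fun _ => volume)
      = ∫⁻ y₀ : Fin T → ℂ, ∏ t, heavyTail δ (y₀ t) := lintegral_congr fun y₀ => by
        rw [lintegral_const_mul _ (by fun_prop),
          lintegral_pi_fin_prod _ (f := fun _ w => ∫⁻ a, rowDensity y₀ w a) (by fun_prop)]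
        simp only [lintegral_lintegral_rowDensity, Finset.prod_const_one, mul_one]
    _ = 1 := by
        rw [volume_pi, lintegral_pi_fin_prod _ (by fun_prop)]
        simp only [lintegral_heavyTail hδ, Finset.prod_const_one]

lemma lintegral_latentDensity (δ : ℝ) (x : Fin T → ℂ) (y : Fin (n + 1) → Fin T → ℂ) :
    ∫⁻ h, latentDensity δ x h y = outputDensity δ y := by
  have hratios : ∀ h₀ : ℂ, h₀ ≠ 0 → ∫⁻ v : Fin n → ℂ, (∏ t, heavyTail δ (y 0 t)) *
      (∏ i : Fin n, ENNReal.ofReal (‖h₀‖ ^ 2)⁻¹ * rowDensity (y 0) (y i.succ) (v i / h₀)) *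
      gainDensity x (y 0) h₀ = outputDensity δ y * gainDensity x (y 0) h₀ := by
    intro h₀ hh₀
    rw [lintegral_mul_const _ (by fun_prop), lintegral_const_mul _ (by fun_prop), volume_pi,
      lintegral_pi_fin_prod _ (f := fun i b => ENNReal.ofReal (‖h₀‖ ^ 2)⁻¹ *
        rowDensity (y 0) (y i.succ) (b / h₀)) (by fun_prop), outputDensity]
    congr 2
    exact Finset.prod_congr rfl fun i _ => lintegral_inv_norm_sq_mul_comp_div (by fun_prop) hh₀
  rw [volume_pi, lintegral_pi_fin_succ _ (by fun_prop)]
  simp only [latentDensity, Fin.cons_zero, Fin.cons_succ]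
  calc _ = ∫⁻ h₀, outputDensity δ y * gainDensity x (y 0) h₀ :=
        lintegral_congr_ae ((Measure.ae_ne volume (0 : ℂ)).mono hratios)
    _ = outputDensity δ y := by
        rw [lintegral_const_mul _ (by fun_prop), lintegral_gainDensity, mul_one]

end LatentModel

section Loss

lemma norm_sub_sum_star_mul_sq_le {n : ℕ} (a : ℂ) (x z : Fin n → ℂ) :
    ‖a - ∑ t, star (x t) * z t‖ ^ 2 ≤ (1 + normSq x) * (‖a‖ ^ 2 + normSq z) := by
  have hnorm : ‖a - ∑ t, star (x t) * z t‖ ≤ ‖a‖ + ∑ t, ‖x t‖ * ‖z t‖ := by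
    refine (norm_sub_le _ _).trans (add_le_add_right ((norm_sum_le _ _).trans_eq ?_) _)
    simp only [norm_mul, norm_star]
  have hcs := Finset.sum_mul_sq_le_sq_mul_sq Finset.univ
    (Fin.cons 1 (fun t => ‖x t‖) : Fin (n + 1) → ℝ) (Fin.cons ‖a‖ fun t => ‖z t‖)
  simp only [Fin.sum_univ_succ, Fin.cons_zero, Fin.cons_succ, one_mul, one_pow] at hcs
  exact (pow_le_pow_left₀ (norm_nonneg _) hnorm 2).trans hcs

lemma sub_sum_star_mul_add_div {n : ℕ} (a : ℂ) (x z : Fin n → ℂ) :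
    a - (∑ t, star (x t) * (a * x t + z t)) / (1 + normSq x) =
      (a - ∑ t, star (x t) * z t) / (1 + normSq x) := by
  have hx : (1 + normSq x : ℂ) ≠ 0 := by
    exact_mod_cast (show 0 < 1 + normSq x by linarith [normSq_nonneg x]).ne'
  have hsum : ∑ t, star (x t) * (a * x t + z t) = normSq x * a + ∑ t, star (x t) * z t := by
    rw [normSq, Complex.ofReal_sum, Finset.sum_mul, ← Finset.sum_add_distrib]
    refine Finset.sum_congr rfl fun t _ => ?_
    rw [Complex.star_def, Complex.ofReal_pow, ← Complex.conj_mul']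
    ring
  rw [hsum]
  field_simp
  ring

lemma logSize_sqrt_mul_sub_div_le {n : ℕ} (a : ℂ) (x z : Fin n → ℂ) :
    logSize (√(1 + normSq x) * (a - (∑ t, star (x t) * (a * x t + z t)) / (1 + normSq x))) ≤
      logSize a + Real.log (1 + normSq z) := by
  have hx : 0 < 1 + normSq x := by linarith [normSq_nonneg x]
  have hz := normSq_nonneg z
  have hnorm : ‖(√(1 + normSq x) : ℂ) * ((a - ∑ t, star (x t) * z t) / (1 + normSq x))‖ ^ 2 ≤
      ‖a‖ ^ 2 + normSq z := by
    have hden : ‖(1 + normSq x : ℂ)‖ = 1 + normSq x := by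
      exact_mod_cast (Complex.norm_real _).trans (Real.norm_of_nonneg hx.le)
    rw [norm_mul, norm_div, hden, Complex.norm_real, Real.norm_of_nonneg (Real.sqrt_nonneg _),
      mul_pow, Real.sq_sqrt hx.le, div_pow, sq (1 + normSq x), ← mul_div_assoc,
      mul_div_mul_left _ _ hx.ne',
      div_le_iff₀' hx]
    exact norm_sub_sum_star_mul_sq_le a x z
  rw [sub_sum_star_mul_add_div]
  unfold logSize
  rw [← Real.log_mul (by positivity) (by linarith)]
  refine Real.log_le_log (by positivity) ?_
  nlinarith [sq_nonneg ‖a‖]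

variable {n T : ℕ}

/-- The part of the loss that does not depend on the input: it bounds the logarithmic sizes of all
the fading coefficients and noise entries, and of `(h 0)⁻¹`. -/
noncomputable def latentCost (h : Fin (n + 1) → ℂ) (z : Fin (n + 1) → Fin T → ℂ) : ℝ :=
  1 + Real.log (1 + normSq h) + ∑ i, Real.log (1 + normSq (z i)) + Real.posLog ‖h 0‖⁻¹

section LatentCost

variable (h : Fin (n + 1) → ℂ) (z : Fin (n + 1) → Fin T → ℂ)

lemma log_one_add_normSq_le_sum (i : Fin (n + 1)) :
    Real.log (1 + normSq (z i)) ≤ ∑ j, Real.log (1 + normSq (z j)) :=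
  Finset.single_le_sum (f := fun j => Real.log (1 + normSq (z j)))
    (fun _ _ => log_one_add_normSq_nonneg _) (Finset.mem_univ i)

lemma logs_le_latentCost (i : Fin (n + 1)) :
    1 + Real.log (1 + normSq h) + Real.log (1 + normSq (z i)) + Real.posLog ‖h 0‖⁻¹ ≤
      latentCost h z := by
  unfold latentCost
  gcongr
  exact log_one_add_normSq_le_sum z i

lemma one_add_logSizes_le_latentCost (i j : Fin (n + 1)) (t : Fin T) :
    1 + logSize (h i) + logSize (z j t) ≤ latentCost h z := by
  linarith [logs_le_latentCost h z j, logSize_apply_le h i, logSize_apply_le (z j) t,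
    Real.posLog_nonneg (x := ‖h 0‖⁻¹)]

lemma one_le_latentCost : 1 ≤ latentCost h z := by
  linarith [logs_le_latentCost h z 0, log_one_add_normSq_nonneg h, log_one_add_normSq_nonneg (z 0),
    Real.posLog_nonneg (x := ‖h 0‖⁻¹)]

lemma logSize_apply_le_latentCost (i : Fin (n + 1)) : logSize (h i) ≤ latentCost h z := by
  linarith [logs_le_latentCost h z 0, logSize_apply_le h i, log_one_add_normSq_nonneg (z 0),
    Real.posLog_nonneg (x := ‖h 0‖⁻¹)]

lemma logSize_div_le_latentCost (i : Fin (n + 1)) (h0 : h 0 ≠ 0) :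
    logSize (h i / h 0) ≤ 2 * latentCost h z := by
  linarith [logSize_div_le (h i) h0, logSize_apply_le h i, logSize_apply_le h 0,
    logs_le_latentCost h z 0, log_one_add_normSq_nonneg (z 0)]

end LatentCost

lemma expNeg_natCast_mul_le_prod {m : ℕ} {f : Fin m → ℝ≥0∞} {c : ℝ}
    (hf : ∀ i, expNeg c ≤ f i) : expNeg (m * c) ≤ ∏ i, f i := by
  have hsum := expNeg_sum Finset.univ fun _ : Fin m => c
  rw [Finset.sum_const, Finset.card_univ, Fintype.card_fin, nsmul_eq_mul] at hsum
  rw [hsum]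
  exact Finset.prod_le_prod' fun i _ => hf i

section LatentDensity

variable (x : Fin T → ℂ) (h : Fin (n + 1) → ℂ) (z : Fin (n + 1) → Fin T → ℂ)

lemma expNeg_le_prod_heavyTail_row_zero {δ : ℝ} (hδ : 0 < δ) (hδ1 : δ ≤ 1) :
    expNeg (T * (Real.log (1 / δ) + (1 + δ) * Real.log (1 + normSq x) + 4 * latentCost h z)) ≤
      ∏ t, heavyTail δ (h 0 * x t + z 0 t) := by
  refine expNeg_natCast_mul_le_prod fun t => (expNeg_antitone ?_).trans (expNeg_le_heavyTail hδ _)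
  have hcost := one_le_latentCost h z
  have hsize : logSize (h 0 * x t + z 0 t) ≤ Real.log (1 + normSq x) + latentCost h z := by
    linarith [logSize_add_le (h 0 * x t) (z 0 t), logSize_mul_le (h 0) (x t),
      logSize_apply_le x t, one_add_logSizes_le_latentCost h z 0 0 t]
  calc 2 + Real.log (1 / δ) + (1 + δ) * logSize (h 0 * x t + z 0 t)
      ≤ 2 + Real.log (1 / δ) + (1 + δ) * (Real.log (1 + normSq x) + latentCost h z) := by gcongr
    _ ≤ _ := by nlinarith

/-- The row `Yᵢ - (hᵢ / h₀) Y₀ = Zᵢ - (hᵢ / h₀) Z₀` does not involve the input. -/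
lemma expNeg_le_rowDensity (i : Fin n) (h0 : h 0 ≠ 0) :
    expNeg (6 * latentCost h z + T * (12 * latentCost h z)) ≤
      rowDensity (fun t => h 0 * x t + z 0 t) (fun t => h i.succ * x t + z i.succ t)
        (h i.succ / h 0) := by
  have hcost := one_le_latentCost h z
  have hratio := logSize_div_le_latentCost h z i.succ h0
  rw [expNeg_add, rowDensity]
  refine mul_le_mul' ((expNeg_antitone (by linarith)).trans (expNeg_le_heavyTail_one _))
    (expNeg_natCast_mul_le_prod fun t =>
      (expNeg_antitone ?_).trans (expNeg_le_heavyTail_one _))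
  have hresidual : h i.succ * x t + z i.succ t - h i.succ / h 0 * (h 0 * x t + z 0 t) =
      z i.succ t + -(h i.succ / h 0 * z 0 t) := by
    field_simp
    ring
  rw [hresidual]
  linarith [logSize_add_le (z i.succ t) (-(h i.succ / h 0 * z 0 t)),
    logSize_neg (h i.succ / h 0 * z 0 t), logSize_mul_le (h i.succ / h 0) (z 0 t),
    one_add_logSizes_le_latentCost h z 0 i.succ t, one_add_logSizes_le_latentCost h z 0 0 t,
    logSize_nonneg (h 0)]

lemma expNeg_latentCost_le_inv_norm_sq (h0 : h 0 ≠ 0) :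
    expNeg (latentCost h z) ≤ ENNReal.ofReal (‖h 0‖ ^ 2)⁻¹ := by
  refine (expNeg_antitone (logSize_apply_le_latentCost h z 0)).trans ?_
  rw [expNeg, logSize, Real.exp_neg, Real.exp_log (by positivity)]
  gcongr
  linarith

lemma expNeg_le_gainDensity :
    expNeg (4 * latentCost h z - Real.log (1 + normSq x)) ≤
      gainDensity x (fun t => h 0 * x t + z 0 t) (h 0) := by
  have hx := normSq_nonneg x
  have hsize := logSize_sqrt_mul_sub_div_le (h 0) x (z 0)
  rw [sub_eq_neg_add, expNeg_add, gainDensity, expNeg, neg_neg, Real.exp_log (by linarith)]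
  refine mul_le_mul' le_rfl ((expNeg_antitone ?_).trans (expNeg_le_heavyTail_one _))
  linarith [one_le_latentCost h z, logs_le_latentCost h z 0, logSize_apply_le h 0,
    Real.posLog_nonneg (x := ‖h 0‖⁻¹)]

lemma expNeg_le_latentDensity {δ : ℝ} (hδ : 0 < δ) (hδ1 : δ ≤ 1) (h0 : h 0 ≠ 0) :
    expNeg (T * Real.log (1 / δ) + (T * (1 + δ) - 1) * Real.log (1 + normSq x) +
        (4 * T + n * (7 + 12 * T) + 4) * latentCost h z) ≤
      latentDensity δ x h (fun i t => h i * x t + z i t) := by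
  have hsplit : T * Real.log (1 / δ) + (T * (1 + δ) - 1) * Real.log (1 + normSq x) +
        (4 * T + n * (7 + 12 * T) + 4) * latentCost h z =
      T * (Real.log (1 / δ) + (1 + δ) * Real.log (1 + normSq x) + 4 * latentCost h z) +
        n * (latentCost h z + (6 * latentCost h z + T * (12 * latentCost h z))) +
        (4 * latentCost h z - Real.log (1 + normSq x)) := by
    ring
  rw [hsplit, expNeg_add, expNeg_add, latentDensity]
  refine mul_le_mul' (mul_le_mul' (expNeg_le_prod_heavyTail_row_zero x h z hδ hδ1)
    (expNeg_natCast_mul_le_prod fun i => ?_)) (expNeg_le_gainDensity x h z)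
  rw [expNeg_add]
  exact mul_le_mul' (expNeg_latentCost_le_inv_norm_sq h z h0) (expNeg_le_rowDensity x h z i h0)

end LatentDensity

end Loss

section Channel

variable {n T : ℕ}

lemma withDensity_mono_of_le {Ω : Type*} [MeasurableSpace Ω] {μ ν : Measure Ω} {f g : Ω → ℝ≥0∞}
    (hμ : μ ≤ ν) (hfg : f ≤ᵐ[ν] g) : μ.withDensity f ≤ ν.withDensity g := by
  refine Measure.le_iff.2 fun s hs => ?_
  rw [withDensity_apply _ hs, withDensity_apply _ hs]
  exact lintegral_mono' (Measure.restrict_mono le_rfl hμ) le_rfl |>.trans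
    (lintegral_mono_ae (ae_restrict_of_ae hfg))

@[fun_prop]
lemma measurable_input {N : ℕ} : Measurable (input (N := N) (T := T)) := measurable_fst

@[fun_prop]
lemma measurable_output {N : ℕ} : Measurable (output (N := N) (T := T)) := by
  unfold output
  fun_prop

/-- The auxiliary law of `(X, H, Z)` under which `X` has law `μX` and, given `X = x`, the pair
`(H, H xᵀ + Z)` has density `latentDensity δ x`. -/
noncomputable def latentLaw (δ : ℝ) (μX : Measure (Fin T → ℂ)) :
    Measure ((Fin T → ℂ) × (Fin (n + 1) → ℂ) × (Fin (n + 1) → Fin T → ℂ)) :=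
  (μX.prod (volume.prod volume)).withDensity
    fun ω => latentDensity δ (input ω) ω.2.1 (output ω)

lemma lintegral_lintegral_mul_latentDensity (δ : ℝ) (x : Fin T → ℂ)
    {G : (Fin (n + 1) → Fin T → ℂ) → ℝ≥0∞} (hG : Measurable G) :
    ∫⁻ h, ∫⁻ z : Fin (n + 1) → Fin T → ℂ, latentDensity δ x h (fun i t => h i * x t + z i t) *
        G (fun i t => h i * x t + z i t) =
      ∫⁻ y, outputDensity δ y * G y :=
  calc ∫⁻ h, ∫⁻ z : Fin (n + 1) → Fin T → ℂ, latentDensity δ x h (fun i t => h i * x t + z i t) *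
          G (fun i t => h i * x t + z i t)
      = ∫⁻ h, ∫⁻ y, latentDensity δ x h y * G y := lintegral_congr fun h =>
        lintegral_add_left_eq_self (μ := volume)
          (fun y : Fin (n + 1) → Fin T → ℂ => latentDensity δ x h y * G y) fun i t => h i * x t
    _ = ∫⁻ y, ∫⁻ h, latentDensity δ x h y * G y := lintegral_lintegral_swap (by fun_prop)
    _ = ∫⁻ y, outputDensity δ y * G y := lintegral_congr fun y => by
        rw [lintegral_mul_const _ (by fun_prop), lintegral_latentDensity]

lemma map_latentLaw (δ : ℝ) (μX : Measure (Fin T → ℂ)) [SFinite μX] :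
    (latentLaw (n := n) δ μX).map (fun ω => (input ω, output ω)) =
      μX.prod (volume.withDensity (outputDensity δ)) := by
  refine Measure.ext_of_lintegral _ fun G hG => ?_
  have hmeas : Measurable fun ω : (Fin T → ℂ) × (Fin (n + 1) → ℂ) × (Fin (n + 1) → Fin T → ℂ) =>
      latentDensity δ (input ω) ω.2.1 (output ω) * G (input ω, output ω) := by fun_prop
  rw [lintegral_map hG (by fun_prop), latentLaw,
    lintegral_withDensity_eq_lintegral_mul _ (by fun_prop) (by fun_prop)]
  simp only [Pi.mul_apply]
  rw [lintegral_prod _ hmeas.aemeasurable, lintegral_prod _ hG.aemeasurable]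
  refine lintegral_congr fun x => ?_
  rw [lintegral_prod _ (by exact (hmeas.comp measurable_prodMk_left).aemeasurable),
    lintegral_withDensity_eq_lintegral_mul _ (by fun_prop) (by fun_prop)]
  exact lintegral_lintegral_mul_latentDensity δ x (G := fun y => G (x, y)) (by fun_prop)

lemma isProbabilityMeasure_withDensity_outputDensity {δ : ℝ} (hδ : 0 < δ) :
    IsProbabilityMeasure (volume.withDensity (outputDensity (n := n) (T := T) δ)) :=
  ⟨by rw [withDensity_apply _ .univ, Measure.restrict_univ, lintegral_outputDensity hδ]⟩

lemma isProbabilityMeasure_latentLaw {δ : ℝ} (hδ : 0 < δ) (μX : Measure (Fin T → ℂ))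
    [IsProbabilityMeasure μX] : IsProbabilityMeasure (latentLaw (n := n) δ μX) := by
  have := isProbabilityMeasure_withDensity_outputDensity (n := n) (T := T) hδ
  refine (Measure.isProbabilityMeasure_map_iff (f := fun ω => (input ω, output ω))
    (by fun_prop)).1 ?_
  rw [map_latentLaw]
  infer_instance

/-- The input-independent part of the loss, in nats. -/
noncomputable def fadingLoss (μH : Measure (Fin (n + 1) → ℂ))
    (p : (Fin (n + 1) → ℂ) × (Fin (n + 1) → Fin T → ℂ)) : ℝ :=
  Real.posLog (μH.rnDeriv volume p.1).toReal +
    (4 * T + n * (7 + 12 * T) + 4) * latentCost p.1 p.2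

/-- The input-dependent part of the loss, in nats. -/
noncomputable def inputLoss (δ : ℝ) (x : Fin T → ℂ) : ℝ :=
  T * Real.log (1 / δ) + (T * (1 + δ) - 1) * Real.log (1 + normSq x)

instance isProbabilityMeasure_sourceLaw {N : ℕ} (μX : Measure (Fin T → ℂ))
    [IsProbabilityMeasure μX] (μH : Measure (Fin N → ℂ)) [IsProbabilityMeasure μH] :
    IsProbabilityMeasure (sourceLaw μX μH) := by
  unfold sourceLaw
  infer_instance

lemma map_input_sourceLaw {N : ℕ} (μX : Measure (Fin T → ℂ)) [SFinite μX]
    (μH : Measure (Fin N → ℂ)) [IsProbabilityMeasure μH] :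
    (sourceLaw μX μH).map input = μX :=
  Measure.fst_prod

lemma withDensity_expNeg_posLog_sourceLaw_le (μX : Measure (Fin T → ℂ)) [SFinite μX]
    {μH : Measure (Fin (n + 1) → ℂ)} [SigmaFinite μH] (hac : μH ≪ volume) :
    (sourceLaw μX μH).withDensity
        (fun ω => expNeg (Real.posLog (μH.rnDeriv volume ω.2.1).toReal)) ≤
      μX.prod (volume.prod volume) := by
  set u : (Fin (n + 1) → ℂ) → ℝ≥0∞ :=
    fun h => expNeg (Real.posLog (μH.rnDeriv volume h).toReal)
  calc (sourceLaw μX μH).withDensity (fun ω => u ω.2.1)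
      = μX.prod ((μH.withDensity u).prod (noiseLaw (n + 1) T)) := by
        rw [sourceLaw, prod_withDensity_left (by fun_prop), prod_withDensity_right (by fun_prop)]
    _ ≤ μX.prod (volume.prod volume) := Measure.prod_mono le_rfl (Measure.prod_mono
        (withDensity_expNeg_posLog_rnDeriv_le hac) (noiseLaw_le_volume _ _))

lemma withDensity_expNeg_sourceLaw_le {δ : ℝ} (hδ : 0 < δ) (hδ1 : δ ≤ 1)
    (μX : Measure (Fin T → ℂ)) [SFinite μX] {μH : Measure (Fin (n + 1) → ℂ)} [SigmaFinite μH]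
    (hac : μH ≪ volume) :
    (sourceLaw μX μH).withDensity (fun ω => expNeg (fadingLoss μH ω.2 + inputLoss δ ω.1)) ≤
      latentLaw δ μX := by
  set v : (Fin T → ℂ) × (Fin (n + 1) → ℂ) × (Fin (n + 1) → Fin T → ℂ) → ℝ≥0∞ := fun ω =>
    expNeg (inputLoss δ ω.1 + (4 * T + n * (7 + 12 * T) + 4) * latentCost ω.2.1 ω.2.2) with hv
  have hv_meas : Measurable v := by
    simp only [hv, inputLoss, latentCost]
    fun_prop
  have hsplit : (fun ω : (Fin T → ℂ) × (Fin (n + 1) → ℂ) × (Fin (n + 1) → Fin T → ℂ) =>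
      expNeg (fadingLoss μH ω.2 + inputLoss δ ω.1)) =
        (fun ω => expNeg (Real.posLog (μH.rnDeriv volume ω.2.1).toReal)) * v := by
    funext ω
    rw [Pi.mul_apply, hv, ← expNeg_add, fadingLoss]
    ring_nf
  have hne : ∀ᵐ ω ∂μX.prod ((volume : Measure (Fin (n + 1) → ℂ)).prod
      (volume : Measure (Fin (n + 1) → Fin T → ℂ))), ω.2.1 0 ≠ 0 :=
    Measure.quasiMeasurePreserving_snd.ae (Measure.quasiMeasurePreserving_fst.ae
      (Measure.ae_eval_ne (μ := fun _ : Fin (n + 1) => (volume : Measure ℂ)) 0 0))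
  rw [hsplit, withDensity_mul _ (by fun_prop) hv_meas]
  exact withDensity_mono_of_le (withDensity_expNeg_posLog_sourceLaw_le μX hac)
    (hne.mono fun ω h0 => expNeg_le_latentDensity ω.1 ω.2.1 ω.2.2 hδ hδ1 h0)

open InformationTheory in
lemma blockInfo_le_integral {δ : ℝ} (hδ : 0 < δ) (hδ1 : δ ≤ 1) {μX : Measure (Fin T → ℂ)}
    [IsProbabilityMeasure μX] {μH : Measure (Fin (n + 1) → ℂ)} [IsProbabilityMeasure μH]
    (hac : μH ≪ volume)
    (hfading : Integrable (fadingLoss (T := T) μH) (μH.prod (noiseLaw (n + 1) T)))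
    (hinput : Integrable (inputLoss δ) μX) :
    blockInfo μX μH ≤ ENNReal.ofReal (∫ p, fadingLoss μH p ∂μH.prod (noiseLaw (n + 1) T) +
      ∫ x, inputLoss δ x ∂μX) / ENNReal.ofReal (Real.log 2) := by
  have := isProbabilityMeasure_withDensity_outputDensity (n := n) (T := T) hδ
  have := isProbabilityMeasure_latentLaw (n := n) hδ μX
  have hint := (hfading.comp_snd μX).add (hinput.comp_fst (μH.prod (noiseLaw (n + 1) T)))
  have hkl := klDiv_le_of_withDensity_expNeg_le (μ := sourceLaw μX μH) hint
    (withDensity_expNeg_sourceLaw_le hδ hδ1 μX hac)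
  refine (mutualInfo_le_klDiv_prod (by fun_prop) (volume.withDensity (outputDensity δ))).trans ?_
  rw [map_input_sourceLaw, ← map_latentLaw]
  gcongr
  refine (klDiv_map_le _ _ (by fun_prop)).trans (hkl.trans_eq ?_)
  simp only [probReal_univ, add_sub_cancel_right]
  rw [sourceLaw, integral_add' (hfading.comp_snd μX) (hinput.comp_fst _)]
  rw [integral_fun_snd, integral_fun_fst]
  simp only [probReal_univ, one_smul]

end Channel

section Power

variable {n T : ℕ}

lemma integrable_latentCost {μH : Measure (Fin (n + 1) → ℂ)} [IsProbabilityMeasure μH]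
    (hent : ⊥ < diffEntropy μH) (hlog : Integrable (fun h => Real.log (1 + normSq h)) μH) :
    Integrable (fun p : (Fin (n + 1) → ℂ) × (Fin (n + 1) → Fin T → ℂ) => latentCost p.1 p.2)
      (μH.prod (noiseLaw (n + 1) T)) := by
  have hnoise : Integrable (fun z : Fin (n + 1) → Fin T → ℂ => ∑ i, Real.log (1 + normSq (z i)))
      (noiseLaw (n + 1) T) := integrable_finsetSum _ fun i _ =>
    integrable_log_one_add (integrable_normSq_noiseLaw i) fun z => normSq_nonneg (z i)
  exact (((integrable_const 1).add (hlog.comp_fst _)).add (hnoise.comp_snd _)).add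
    ((integrable_posLog_inv_norm hent hlog 0).comp_fst _)

lemma integrable_fadingLoss {μH : Measure (Fin (n + 1) → ℂ)} [IsProbabilityMeasure μH]
    (hent : ⊥ < diffEntropy μH) (hlog : Integrable (fun h => Real.log (1 + normSq h)) μH) :
    Integrable (fadingLoss (T := T) μH) (μH.prod (noiseLaw (n + 1) T)) :=
  ((integrable_posLog_rnDeriv_of_bot_lt_diffEntropy hent).comp_fst _).add
    ((integrable_latentCost hent hlog).const_mul _)

lemma integrable_normSq {μ : Measure (Fin n → ℂ)} (h : ∫⁻ v, ENNReal.ofReal (normSq v) ∂μ ≠ ∞) :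
    Integrable normSq μ :=
  (lintegral_ofReal_ne_top_iff_integrable measurable_normSq.aestronglyMeasurable
    (ae_of_all _ normSq_nonneg)).1 h

lemma integral_log_one_add_le {Ω : Type*} [MeasurableSpace Ω] {μ : Measure Ω}
    [IsProbabilityMeasure μ] {f : Ω → ℝ} (hf : Integrable f μ) (hf_nonneg : ∀ ω, 0 ≤ f ω) :
    ∫ ω, Real.log (1 + f ω) ∂μ ≤ Real.log (1 + ∫ ω, f ω ∂μ) := by
  have hconcave : ConcaveOn ℝ (Set.Ici 1) Real.log :=
    strictConcaveOn_log_Ioi.concaveOn.subset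
      (fun r (hr : 1 ≤ r) => zero_lt_one.trans_le hr) (convex_Ici 1)
  have hcont : ContinuousOn Real.log (Set.Ici 1) :=
    Real.continuousOn_log.mono fun r (hr : 1 ≤ r) => (zero_lt_one.trans_le hr).ne'
  have hjensen := hconcave.le_map_integral hcont isClosed_Ici
    (ae_of_all μ fun ω => le_add_of_nonneg_right (hf_nonneg ω))
    ((integrable_const 1).add hf) (integrable_log_one_add hf hf_nonneg)
  rwa [integral_add (integrable_const _) hf, integral_const, probReal_univ, one_smul] at hjensen

variable {P : ℝ} {μX : Measure (Fin T → ℂ)}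

lemma AveragePower.integrable_normSq (h : AveragePower P μX) : Integrable normSq μX :=
  SIMO.integrable_normSq (ne_top_of_le_ne_top ENNReal.ofReal_ne_top h)

lemma AveragePower.integral_normSq_le (hP : 0 ≤ P) (h : AveragePower P μX) :
    ∫ x, normSq x ∂μX ≤ P * T := by
  rw [integral_eq_lintegral_of_nonneg_ae (ae_of_all _ normSq_nonneg)
    measurable_normSq.aestronglyMeasurable]
  exact ENNReal.toReal_le_of_le_ofReal (by positivity) h

variable [IsProbabilityMeasure μX]

lemma AveragePower.integral_log_one_add_normSq_le (hP : 0 ≤ P) (h : AveragePower P μX) :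
    ∫ x, Real.log (1 + normSq x) ∂μX ≤ Real.log (1 + P * T) := by
  have hmean : 0 ≤ ∫ x, normSq x ∂μX := integral_nonneg normSq_nonneg
  refine (integral_log_one_add_le h.integrable_normSq normSq_nonneg).trans ?_
  gcongr
  exact h.integral_normSq_le hP

lemma AveragePower.integrable_inputLoss (h : AveragePower P μX) (δ : ℝ) :
    Integrable (inputLoss δ) μX :=
  (integrable_const _).add
    ((integrable_log_one_add h.integrable_normSq normSq_nonneg).const_mul _)

lemma AveragePower.integral_inputLoss_le (hP : 0 ≤ P) (h : AveragePower P μX) (hT : 1 ≤ T)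
    {δ : ℝ} (hδ : 0 ≤ δ) :
    ∫ x, inputLoss δ x ∂μX ≤
      T * Real.log (1 / δ) + (T * (1 + δ) - 1) * Real.log (1 + P * T) := by
  have hT_real : (1 : ℝ) ≤ T := by exact_mod_cast hT
  have hlog := integrable_log_one_add h.integrable_normSq normSq_nonneg
  unfold inputLoss
  rw [integral_add (integrable_const _) (hlog.const_mul _), integral_const, probReal_univ,
    one_smul, integral_const_mul]
  gcongr
  · nlinarith
  · exact h.integral_log_one_add_normSq_le hP

lemma AveragePower.blockInfo_le (hP : 0 ≤ P) (h : AveragePower P μX) (hT : 1 ≤ T)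
    {μH : Measure (Fin (n + 1) → ℂ)} [IsProbabilityMeasure μH] (hent : ⊥ < diffEntropy μH)
    (hlog : Integrable (fun h => Real.log (1 + normSq h)) μH)
    {δ : ℝ} (hδ : 0 < δ) (hδ1 : δ ≤ 1) :
    blockInfo μX μH ≤ ENNReal.ofReal (∫ p, fadingLoss μH p ∂μH.prod (noiseLaw (n + 1) T) +
      (T * Real.log (1 / δ) + (T * (1 + δ) - 1) * Real.log (1 + P * T))) /
        ENNReal.ofReal (Real.log 2) := by
  refine (blockInfo_le_integral hδ hδ1 (absolutelyContinuous_of_bot_lt_diffEntropy hent)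
    (integrable_fadingLoss hent hlog) (h.integrable_inputLoss δ)).trans ?_
  gcongr
  exact h.integral_inputLoss_le hP hT hδ.le

end Power

section HighSNR

lemma tendsto_logb_logb_atTop :
    Tendsto (fun P : ℝ => Real.logb 2 (Real.logb 2 P)) atTop atTop :=
  (Real.tendsto_logb_atTop one_lt_two).comp (Real.tendsto_logb_atTop one_lt_two)

lemma tendsto_logb_logb_div_logb_atTop :
    Tendsto (fun P : ℝ => Real.logb 2 (Real.logb 2 P) / Real.logb 2 P) atTop (nhds 0) := by
  have hlogb : Tendsto (fun u : ℝ => Real.logb 2 u / u) atTop (nhds 0) := by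
    simpa [Real.logb, div_right_comm] using
      Real.isLittleO_log_id_atTop.tendsto_div_nhds_zero.div_const (Real.log 2)
  exact hlogb.comp (Real.tendsto_logb_atTop one_lt_two)

/-- With the shape parameter `δ = 1 / log P`, the excess exponent `T δ` costs only
`T δ log P = T` nats, while the normalization `log (1 / δ)` costs `log log P`. -/
lemma inputLoss_at_inv_log_le {T P : ℝ} (hT : 1 ≤ T) (hP : Real.exp 1 ≤ P) :
    T * Real.log (1 / (Real.log P)⁻¹) +
        (T * (1 + (Real.log P)⁻¹) - 1) * Real.log (1 + P * T) ≤
      (T - 1) * Real.log P + T * Real.log (Real.log P) + (T + 2 * T * Real.log (1 + T)) := by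
  have hP0 : 0 < P := (Real.exp_pos 1).trans_le hP
  have hP1 : 1 ≤ P := (Real.one_le_exp zero_le_one).trans hP
  have hL : 1 ≤ Real.log P := (Real.le_log_iff_exp_le hP0).2 hP
  have hδ : 0 < (Real.log P)⁻¹ := by positivity
  have hδ1 : (Real.log P)⁻¹ ≤ 1 := inv_le_one_of_one_le₀ hL
  have hlogT : 0 ≤ Real.log (1 + T) := Real.log_nonneg (by linarith)
  have hlogPT : Real.log (1 + P * T) ≤ Real.log P + Real.log (1 + T) := by
    rw [← Real.log_mul hP0.ne' (by positivity)]
    exact Real.log_le_log (by positivity) (by nlinarith)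
  rw [one_div, inv_inv]
  calc T * Real.log (Real.log P) + (T * (1 + (Real.log P)⁻¹) - 1) * Real.log (1 + P * T)
      ≤ T * Real.log (Real.log P) +
          (T * (1 + (Real.log P)⁻¹) - 1) * (Real.log P + Real.log (1 + T)) := by
        gcongr
        nlinarith
    _ = (T - 1) * Real.log P + T * Real.log (Real.log P) +
          (T + (T * (1 + (Real.log P)⁻¹) - 1) * Real.log (1 + T)) := by
        field_simp
        ring
    _ ≤ (T - 1) * Real.log P + T * Real.log (Real.log P) + (T + 2 * T * Real.log (1 + T)) := by
        gcongr
        nlinarith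

lemma log_log_le_logb_logb_mul_log {P : ℝ} (hP : 1 < P) :
    Real.log (Real.log P) ≤ Real.logb 2 (Real.logb 2 P) * Real.log 2 := by
  have hL : 0 < Real.log P := Real.log_pos hP
  have hlog2 : 0 < Real.log 2 := Real.log_pos one_lt_two
  have hle : Real.log P ≤ Real.logb 2 P := by
    rw [Real.logb, le_div_iff₀ hlog2]
    nlinarith [Real.log_two_lt_d9]
  rw [Real.logb, div_mul_cancel₀ _ hlog2.ne']
  exact Real.log_le_log hL hle

lemma eventually_add_inputLoss_le {T : ℝ} (hT : 1 ≤ T) (K : ℝ) :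
    ∀ᶠ P : ℝ in atTop,
      K + (T * Real.log (1 / (Real.log P)⁻¹) +
        (T * (1 + (Real.log P)⁻¹) - 1) * Real.log (1 + P * T)) ≤
      ((T - 1) * Real.logb 2 P + (T + 1) * Real.logb 2 (Real.logb 2 P)) * Real.log 2 := by
  have hlog2 : 0 < Real.log 2 := Real.log_pos one_lt_two
  filter_upwards [eventually_ge_atTop (Real.exp 1), (tendsto_logb_logb_atTop.atTop_mul_const
    hlog2).eventually_ge_atTop (K + (T + 2 * T * Real.log (1 + T)))] with P hP hK
  have hP1 : 1 < P := (Real.one_lt_exp_iff.2 one_pos).trans_le hP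
  have hlog : Real.logb 2 P * Real.log 2 = Real.log P := div_mul_cancel₀ _ hlog2.ne'
  have hloglog : T * Real.log (Real.log P) ≤
      T * (Real.logb 2 (Real.logb 2 P) * Real.log 2) := by
    gcongr
    exact log_log_le_logb_logb_mul_log hP1
  calc K + (T * Real.log (1 / (Real.log P)⁻¹) +
        (T * (1 + (Real.log P)⁻¹) - 1) * Real.log (1 + P * T))
      ≤ (T - 1) * (Real.logb 2 P * Real.log 2) +
          T * (Real.logb 2 (Real.logb 2 P) * Real.log 2) +
          Real.logb 2 (Real.logb 2 P) * Real.log 2 := by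
        rw [hlog]
        linarith [inputLoss_at_inv_log_le hT hP]
    _ = _ := by ring

lemma eventually_blockInfo_le {n T : ℕ} (hT : 1 ≤ T) {μH : Measure (Fin (n + 1) → ℂ)}
    [IsProbabilityMeasure μH] (hent : ⊥ < diffEntropy μH)
    (hlog : Integrable (fun h => Real.log (1 + normSq h)) μH) :
    ∀ᶠ P : ℝ in atTop, ∀ μX : Measure (Fin T → ℂ), IsProbabilityMeasure μX →
      AveragePower P μX → blockInfo μX μH ≤ ENNReal.ofReal
        (((T : ℝ) - 1) * Real.logb 2 P + (T + 1) * Real.logb 2 (Real.logb 2 P)) := by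
  filter_upwards [eventually_ge_atTop (Real.exp 1), eventually_add_inputLoss_le
    (Nat.one_le_cast.2 hT) (∫ p, fadingLoss (T := T) μH p ∂μH.prod (noiseLaw (n + 1) T))]
    with P hP hbound μX _ hpower
  have hP0 : 0 < P := (Real.exp_pos 1).trans_le hP
  have hL : 1 ≤ Real.log P := (Real.le_log_iff_exp_le hP0).2 hP
  refine (hpower.blockInfo_le hP0.le hT hent hlog (by positivity)
    (inv_le_one_of_one_le₀ hL)).trans (ENNReal.div_le_of_le_mul ?_)
  rw [← ENNReal.ofReal_mul' (Real.log_nonneg one_le_two)]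
  exact ENNReal.ofReal_le_ofReal hbound

lemma capacity_le {N T : ℕ} (hT : 1 ≤ T) {μH : Measure (Fin N → ℂ)} {P b : ℝ}
    (h : ∀ μX : Measure (Fin T → ℂ), IsProbabilityMeasure μX → AveragePower P μX →
      blockInfo μX μH ≤ ENNReal.ofReal b) :
    capacity T μH P ≤ ENNReal.ofReal (b / T) := by
  refine iSup_le fun μX => iSup_le fun hX => iSup_le fun hpower => ?_
  rw [ENNReal.ofReal_div_of_pos (Nat.cast_pos.2 hT), ENNReal.ofReal_natCast]
  gcongr
  exact h μX hX hpower

lemma IsAchievableDoF.le_of_eventually_capacity_le {N T : ℕ} {μH : Measure (Fin N → ℂ)}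
    {d : EReal} (hd : IsAchievableDoF T μH d) {a b : ℝ} (ha : 0 ≤ a)
    (h : ∀ᶠ P : ℝ in atTop, capacity T μH P ≤
      ENNReal.ofReal (a * Real.logb 2 P + b * Real.logb 2 (Real.logb 2 P))) :
    d ≤ (a : EReal) := by
  obtain ⟨R, hR, rfl⟩ := hd
  have hlim : Tendsto (fun P : ℝ =>
      ((max (a + b * (Real.logb 2 (Real.logb 2 P) / Real.logb 2 P)) 0 : ℝ) : EReal))
      atTop (nhds (a : EReal)) := by
    refine (continuous_coe_real_ereal.tendsto a).comp ?_
    simpa [ha] using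
      ((tendsto_logb_logb_div_logb_atTop.const_mul b).const_add a).max
        (tendsto_const_nhds (x := (0 : ℝ)))
  rw [← hlim.liminf_eq]
  refine liminf_le_liminf ?_
  filter_upwards [h, eventually_gt_atTop 1] with P hcap hP
  have hL : 0 < Real.logb 2 P := Real.logb_pos one_lt_two hP
  have hRle := (hR P (zero_lt_one.trans hP)).trans (EReal.coe_ennreal_le_coe_ennreal_iff.2 hcap)
  rw [EReal.coe_ennreal_ofReal, EReal.coe_le_coe_iff] at hRle
  rw [EReal.coe_le_coe_iff, div_le_iff₀ hL, max_mul_of_nonneg _ _ hL.le]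
  refine hRle.trans_eq ?_
  rw [zero_mul]
  congr 1
  field_simp

lemma coe_ennreal_le_coe_real {x : ℝ≥0∞} {r : ℝ} (hr : 0 ≤ r) (h : x ≤ ENNReal.ofReal r) :
    (x : EReal) ≤ (r : EReal) := by
  simpa [hr] using EReal.coe_ennreal_le_coe_ennreal_iff.2 h

end HighSNR

end SIMO

theorem mainTheorem2_general (N T : ℕ) (hN : 1 ≤ N) (hT : 1 ≤ T)
    (μH : Measure (Fin N → ℂ)) [IsProbabilityMeasure μH]
    (hent : ⊥ < SIMO.diffEntropy μH)
    (hlog : Integrable (fun h => Real.log (1 + SIMO.normSq h)) μH) :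
    (∃ c : ℝ, 0 < c ∧ ∃ P₀ : ℝ, ∀ P : ℝ, P₀ ≤ P →
      ∀ μX : Measure (Fin T → ℂ), IsProbabilityMeasure μX →
        SIMO.AveragePower P μX →
        (SIMO.blockInfo μX μH : EReal) ≤
          ((((T : ℝ) - 1) * max (Real.logb 2 P) 0
            + c * Real.logb 2 (Real.logb 2 P) : ℝ) : EReal)) ∧
    (∀ d : EReal, SIMO.IsAchievableDoF T μH d → d ≤ ((1 - 1 / (T : ℝ) : ℝ) : EReal)) := by
  obtain ⟨n, rfl⟩ := Nat.exists_eq_add_of_le' hN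
  have hT_real : (1 : ℝ) ≤ T := by exact_mod_cast hT
  have hinfo := SIMO.eventually_blockInfo_le hT hent hlog
  constructor
  · obtain ⟨P₀, hP₀⟩ := (hinfo.and
      (SIMO.tendsto_logb_logb_atTop.eventually_ge_atTop 0)).exists_forall_of_atTop
    refine ⟨T + 1, by positivity, P₀, fun P hP μX hX hpower => ?_⟩
    obtain ⟨hinfo_le, hloglog⟩ := hP₀ P hP
    have : (0 : ℝ) ≤ T - 1 := sub_nonneg.2 hT_real
    refine SIMO.coe_ennreal_le_coe_real (by positivity) ((hinfo_le μX hX hpower).trans ?_)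
    gcongr
    exact le_max_left _ _
  · refine fun d hd => hd.le_of_eventually_capacity_le (b := (T + 1) / T)
      (sub_nonneg.2 (div_le_one_of_le₀ hT_real (by positivity))) ?_
    filter_upwards [hinfo] with P hP
    convert SIMO.capacity_le hT hP using 2
    field_simp

theorem mainTheorem2 (N T : ℕ) (hN : 1 ≤ N) (hT : 1 ≤ T)
    (μH : MeasureTheory.Measure (Fin N → ℂ)) [MeasureTheory.IsProbabilityMeasure μH]
    (hent : ⊥ < SIMO.diffEntropy μH)
    (hmom : ∫⁻ h, ENNReal.ofReal (SIMO.normSq h) ∂μH < ⊤) :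
    (∃ c : ℝ, 0 < c ∧ ∃ P₀ : ℝ, ∀ P : ℝ, P₀ ≤ P →
      ∀ μX : MeasureTheory.Measure (Fin T → ℂ), MeasureTheory.IsProbabilityMeasure μX →
        SIMO.AveragePower P μX →
        (SIMO.blockInfo μX μH : EReal) ≤
          ((((T : ℝ) - 1) * max (Real.logb 2 P) 0
            + c * Real.logb 2 (Real.logb 2 P) : ℝ) : EReal)) ∧
    (∀ d : EReal, SIMO.IsAchievableDoF T μH d → d ≤ ((1 - 1 / (T : ℝ) : ℝ) : EReal)) :=
  mainTheorem2_general N T hN hT μH hent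
    (SIMO.integrable_log_one_add (SIMO.integrable_normSq hmom.ne) SIMO.normSq_nonneg)
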